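/- Let $(V,h)$ be a three-dimensional real vector space with a nondegenerate symmetric bilinear form $h$ of signature $(-,+,+)$ (e.g. $\mathbb R^3_1$), and let $SO(1,2)$ be the group of linear automorphisms of $V$ of determinant $1$ preserving $h$. Let $K:V\times V\to V$ be bilinear such that $h(K(X,Y),Z)$ is totally symmetric in $X,Y,Z$ and $\operatorname{tr}K_X=0$ for all $X\in V$, where $K_X=K(X,\cdot)$. Its stabilizer is $$\mathrm{Stab}(K)=\{L\in SO(1,2): h(K(LX,LY),LZ)=h(K(X,Y),Z)\ \ \forall X,Y,Z\in V\}.$$ An ONB is a basis $(\mathbf t,\mathbf v,\mathbf w)$ with $h(\mathbf t,\mathbf t)=-1$, $h(\mathbf v,\mathbf v)=h(\mathbf w,\mathbf w)=1$ and all other products zero; an LVB is a basis $(\mathbf e,\mathbf v,\mathbf f)$ with $h(\mathbf e,\mathbf f)=h(\mathbf v,\mathbf v)=1$ and all other products zero. The coefficients $a_1,\dots,a_7$ of $K$ in an ONB are defined by $$K_{\mathbf t}=\begin{pmatrix}-a_1&-a_2&-a_3\\a_2&a_4&a_5\\a_3&a_5&a_1-a_4\end{pmatrix},\quad K_{\mathbf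 v}=\begin{pmatrix}-a_2&-a_4&-a_5\\a_4&a_6&a_7\\a_5&a_7&a_2-a_6\end{pmatrix},\quad K_{\mathbf w}=\begin{pmatrix}-a_3&-a_5&-(a_1-a_4)\\a_5&a_7&a_2-a_6\\a_1-a_4&a_2-a_6&a_3-a_7\end{pmatrix},$$ and the coefficients $b_1,\dots,b_7$ in an LVB by $$K_{\mathbf e}=\begin{pmatrix}b_1&b_4&b_5\\b_2&-2b_1&b_4\\b_3&b_2&b_1\end{pmatrix},\quad K_{\mathbf v}=\begin{pmatrix}b_4&-2b_5&b_6\\-2b_1&-2b_4&-2b_5\\b_2&-2b_1&b_4\end{pmatrix},\quad K_{\mathbf f}=\begin{pmatrix}b_5&b_6&b_7\\b_4&-2b_5&b_6\\b_1&b_4&b_5\end{pmatrix}.$$ With respect to such a basis put $$A_s=\begin{pmatrix}1&0&0\\0&\cos s&-\sin s\\0&\sin s&\cos s\end{pmatrix},\quad B=\begin{pmatrix}-1&0&0\\0&1&0\\0&0&-1\end{pmatrix},\quad C_l=\begin{pmatrix}l&0&0\\0&1&0\\0&0&\frac1l\end{pmatrix},\quad N_m=\begin{pmatrix}1&-m&-\frac{m^2}2\\0&1&m\\0&0&1\end{pmatrix}.$$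 Assume that $\mathrm{Stab}(K)$ contains an element different from the identity. Then exactly one of the following nine statements holds (coefficients that are not mentioned are zero): 1. $K=0$, and $\mathrm{Stab}(K)=SO(1,2)$; 2. there is an ONB in which $a_1=2a_4$, $a_4>0$, and $\mathrm{Stab}(K)=\{A_s:s\in\mathbb R\}\cong SO(2)$; 3. there is an ONB in which $a_6>0$, and $\mathrm{Stab}(K)=\langle A_{2\pi/3},B\rangle\cong S_3$; 4. there is an ONB in which $a_1=2a_4$, $a_4>0$, $a_6>0$, and $\mathrm{Stab}(K)=\langle A_{2\pi/3}\rangle\cong\mathbb Z_3$; 5. there is an ONB in which $a_2,a_5\in\mathbb R$, $a_6\ge0$, $(a_2,a_6)\ne(0,0)$, and $\mathrm{Stab}(K)=\langle B\rangle\cong\mathbb Z_2$; 6. there is an ONB in which $a_5>0$, and $\mathrm{Stab}(K)=\langle A_\pi,B\rangle\cong\mathbb Z_2\times\mathbb Z_2$; 7. there is an ONB in which $a_1>0$ or $a_4>0$, $a_1\ne2a_4$, and $\mathrm{Stab}(K)=\langle A_\pi\rangle\cong\mathbb Z_2$; 8. there is an LVB in which $b_4>0$, and $\mathrm{Stab}(K)=\{C_l:l\in\mathbb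 R\setminus\{0\}\}\cong SO(1,1)$; 9. there is an LVB in which $b_7>0$, and $\mathrm{Stab}(K)=\{N_m:m\in\mathbb R\}\cong(\mathbb R,+)$. Moreover, whenever $K$ has one of these nine forms in some ONB (respectively LVB), the group listed with that form, taken with respect to that basis, is contained in $\mathrm{Stab}(K)$; for all forms except 5 and 7 it is equal to $\mathrm{Stab}(K)$. -/

import Mathlib

open LinearMap (BilinForm)

noncomputable section

namespace LorentzCubic

variable {V : Type*} [AddCommGroup V] [Module ℝ V]

/-- The special isometry group of a bilinear form: linear automorphisms of determinant one
which preserve the form. -/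
def specialIsometryGroup (h : BilinForm ℝ V) : Subgroup (V ≃ₗ[ℝ] V) where
  carrier := {L | (∀ x y, h (L x) (L y) = h x y) ∧ LinearMap.det (L : V →ₗ[ℝ] V) = 1}
  one_mem' := ⟨fun _ _ => rfl, LinearMap.det_id⟩
  mul_mem' := by
    rintro L M ⟨hL, dL⟩ ⟨hM, dM⟩
    refine ⟨fun x y => ?_, ?_⟩
    · rw [LinearEquiv.mul_apply, LinearEquiv.mul_apply, hL, hM]
    · have : ((L * M : V ≃ₗ[ℝ] V) : V →ₗ[ℝ] V) = (L : V →ₗ[ℝ] V) * (M : V →ₗ[ℝ] V) := rfl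
      rw [this, map_mul, dL, dM, one_mul]
  inv_mem' := by
    rintro L ⟨hL, dL⟩
    refine ⟨fun x y => ?_, ?_⟩
    · have e : ∀ z, L (L⁻¹ z) = z := fun z => L.apply_symm_apply z
      rw [← hL, e, e]
    · have : (L : V →ₗ[ℝ] V) * ((L⁻¹ : V ≃ₗ[ℝ] V) : V →ₗ[ℝ] V) = 1 := by
        ext z
        exact L.apply_symm_apply z
      have h2 := congrArg LinearMap.det this
      rw [map_mul, dL, one_mul, map_one] at h2
      exact h2

/-- The standard Lorentzian form `-x₀ y₀ + x₁ y₁ + ⋯ + xₙ yₙ`. -/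
def lorentzForm (n : ℕ) : BilinForm ℝ (Fin (n + 1) → ℝ) :=
  Matrix.toBilin' (Matrix.diagonal (Fin.cons (-1) (fun _ => 1)))

/-- The group `SO(1,n)`. -/
abbrev SO1 (n : ℕ) : Subgroup ((Fin (n + 1) → ℝ) ≃ₗ[ℝ] (Fin (n + 1) → ℝ)) :=
  specialIsometryGroup (lorentzForm n)

/-- Orthonormal basis `(t, v, w) = (b 0, b 1, b 2)` with `t` timelike, `v`, `w` spacelike. -/
def IsONB (h : BilinForm ℝ V) (b : Module.Basis (Fin 3) ℝ V) : Prop :=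
  h (b 0) (b 0) = -1 ∧ h (b 1) (b 1) = 1 ∧ h (b 2) (b 2) = 1 ∧
    h (b 0) (b 1) = 0 ∧ h (b 0) (b 2) = 0 ∧ h (b 1) (b 2) = 0

/-- Light-vector basis `(e, v, f) = (b 0, b 1, b 2)` with `e`, `f` lightlike, `v` spacelike. -/
def IsLVB (h : BilinForm ℝ V) (b : Module.Basis (Fin 3) ℝ V) : Prop :=
  h (b 0) (b 0) = 0 ∧ h (b 2) (b 2) = 0 ∧ h (b 0) (b 2) = 1 ∧
    h (b 0) (b 1) = 0 ∧ h (b 2) (b 1) = 0 ∧ h (b 1) (b 1) = 1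

/-- `h (K(X,Y), Z)` is totally symmetric in `X, Y, Z`, and every `K_X = K(X, ·)` is traceless. -/
def IsTracelessCubic (h : BilinForm ℝ V) (K : V →ₗ[ℝ] V →ₗ[ℝ] V) : Prop :=
  (∀ X Y Z, h (K X Y) Z = h (K Y X) Z) ∧ (∀ X Y Z, h (K X Y) Z = h (K X Z) Y) ∧
    ∀ X, LinearMap.trace ℝ V (K X) = 0

/-- The stabilizer, in the special isometry group of `h`, of the cubic form `h (K(·,·), ·)`
under `L ↦ h (K(L·, L·), L·)`. -/
def cubicStabilizer (h : BilinForm ℝ V) (K : V →ₗ[ℝ] V →ₗ[ℝ] V) : Subgroup (V ≃ₗ[ℝ] V) where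
  carrier := {L | L ∈ specialIsometryGroup h ∧
    ∀ X Y Z, h (K (L X) (L Y)) (L Z) = h (K X Y) Z}
  one_mem' := ⟨one_mem _, fun _ _ _ => rfl⟩
  mul_mem' := by
    rintro L M ⟨hL, kL⟩ ⟨hM, kM⟩
    refine ⟨mul_mem hL hM, fun X Y Z => ?_⟩
    rw [LinearEquiv.mul_apply, LinearEquiv.mul_apply, LinearEquiv.mul_apply, kL, kM]
  inv_mem' := by
    rintro L ⟨hL, kL⟩
    refine ⟨inv_mem hL, fun X Y Z => ?_⟩
    have e : ∀ z, L (L⁻¹ z) = z := fun z => L.apply_symm_apply z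
    rw [← kL, e, e, e]

/-- The coefficients of `K` with respect to an orthonormal basis `(t, v, w)`: the matrices of
`K_t`, `K_v`, `K_w` in this basis. -/
def HasONBCoeffs (K : V →ₗ[ℝ] V →ₗ[ℝ] V) (b : Module.Basis (Fin 3) ℝ V)
    (a₁ a₂ a₃ a₄ a₅ a₆ a₇ : ℝ) : Prop :=
  LinearMap.toMatrix b b (K (b 0)) =
    !![-a₁, -a₂, -a₃; a₂, a₄, a₅; a₃, a₅, a₁ - a₄] ∧
  LinearMap.toMatrix b b (K (b 1)) =
    !![-a₂, -a₄, -a₅; a₄, a₆, a₇; a₅, a₇, a₂ - a₆] ∧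
  LinearMap.toMatrix b b (K (b 2)) =
    !![-a₃, -a₅, -(a₁ - a₄); a₅, a₇, a₂ - a₆; a₁ - a₄, a₂ - a₆, a₃ - a₇]

/-- The coefficients of `K` with respect to a light-vector basis `(e, v, f)`: the matrices of
`K_e`, `K_v`, `K_f` in this basis. -/
def HasLVBCoeffs (K : V →ₗ[ℝ] V →ₗ[ℝ] V) (b : Module.Basis (Fin 3) ℝ V)
    (b₁ b₂ b₃ b₄ b₅ b₆ b₇ : ℝ) : Prop :=
  LinearMap.toMatrix b b (K (b 0)) =
    !![b₁, b₄, b₅; b₂, -2 * b₁, b₄; b₃, b₂, b₁] ∧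
  LinearMap.toMatrix b b (K (b 1)) =
    !![b₄, -2 * b₅, b₆; -2 * b₁, -2 * b₄, -2 * b₅; b₂, -2 * b₁, b₄] ∧
  LinearMap.toMatrix b b (K (b 2)) =
    !![b₅, b₆, b₇; b₄, -2 * b₅, b₆; b₁, b₄, b₅]

/-- Rotation by the angle `s` fixing the timelike vector of an orthonormal basis. -/
def matA (s : ℝ) : Matrix (Fin 3) (Fin 3) ℝ :=
  !![1, 0, 0; 0, Real.cos s, -Real.sin s; 0, Real.sin s, Real.cos s]

/-- Half-turn about the spacelike vector `b 1`. -/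
def matB : Matrix (Fin 3) (Fin 3) ℝ := !![-1, 0, 0; 0, 1, 0; 0, 0, -1]

/-- Boost with respect to a light-vector basis. -/
def matC (l : ℝ) : Matrix (Fin 3) (Fin 3) ℝ := !![l, 0, 0; 0, 1, 0; 0, 0, 1 / l]

/-- Null rotation with respect to a light-vector basis. -/
def matN (m : ℝ) : Matrix (Fin 3) (Fin 3) ℝ := !![1, -m, -(m ^ 2 / 2); 0, 1, m; 0, 0, 1]

/-- The automorphisms represented by the matrix `A` in the basis `b`
(exactly one if `A` is invertible). -/
def represented (b : Module.Basis (Fin 3) ℝ V) (A : Matrix (Fin 3) (Fin 3) ℝ) :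
    Set (V ≃ₗ[ℝ] V) :=
  {L | LinearMap.toMatrix b b (L : V →ₗ[ℝ] V) = A}

/-- Labels of the nine normal forms; the two forms with symmetry `ℤ/2` are labelled by the
generator, `B` or `A_π`. -/
inductive FormType
  | zero
  | so2
  | s3
  | z3
  | z2B
  | z2z2
  | z2A
  | so11
  | real

/-- The kind of basis used for each normal form. -/
def IsAdapted (h : BilinForm ℝ V) (b : Module.Basis (Fin 3) ℝ V) : FormType → Prop
  | .so11 => IsLVB h b
  | .real => IsLVB h b
  | _ => IsONB h b

/-- `K` has the normal form with the given label in the basis `b`. -/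
def HasNormalForm (K : V →ₗ[ℝ] V →ₗ[ℝ] V) (b : Module.Basis (Fin 3) ℝ V) : FormType → Prop
  | .zero => K = 0
  | .so2 => ∃ a₄ : ℝ, 0 < a₄ ∧ HasONBCoeffs K b (2 * a₄) 0 0 a₄ 0 0 0
  | .s3 => ∃ a₆ : ℝ, 0 < a₆ ∧ HasONBCoeffs K b 0 0 0 0 0 a₆ 0
  | .z3 => ∃ a₄ a₆ : ℝ, 0 < a₄ ∧ 0 < a₆ ∧ HasONBCoeffs K b (2 * a₄) 0 0 a₄ 0 a₆ 0
  | .z2B => ∃ a₂ a₅ a₆ : ℝ, 0 ≤ a₆ ∧ (a₂, a₆) ≠ (0, 0) ∧ HasONBCoeffs K b 0 a₂ 0 0 a₅ a₆ 0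
  | .z2z2 => ∃ a₅ : ℝ, 0 < a₅ ∧ HasONBCoeffs K b 0 0 0 0 a₅ 0 0
  | .z2A => ∃ a₁ a₄ : ℝ, (0 < a₁ ∨ 0 < a₄) ∧ a₁ ≠ 2 * a₄ ∧ HasONBCoeffs K b a₁ 0 0 a₄ 0 0 0
  | .so11 => ∃ b₄ : ℝ, 0 < b₄ ∧ HasLVBCoeffs K b 0 0 0 b₄ 0 0 0
  | .real => ∃ b₇ : ℝ, 0 < b₇ ∧ HasLVBCoeffs K b 0 0 0 0 0 0 b₇

/-- The group attached to each normal form, with respect to the basis `b`. -/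
def symmetrySet (h : BilinForm ℝ V) (b : Module.Basis (Fin 3) ℝ V) :
    FormType → Set (V ≃ₗ[ℝ] V)
  | .zero => specialIsometryGroup h
  | .so2 => {L | ∃ s : ℝ, L ∈ represented b (matA s)}
  | .s3 => Subgroup.closure (represented b (matA (2 * Real.pi / 3)) ∪ represented b matB)
  | .z3 => Subgroup.closure (represented b (matA (2 * Real.pi / 3)))
  | .z2B => Subgroup.closure (represented b matB)
  | .z2z2 => Subgroup.closure (represented b (matA Real.pi) ∪ represented b matB)
  | .z2A => Subgroup.closure (represented b (matA Real.pi))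
  | .so11 => {L | ∃ l : ℝ, l ≠ 0 ∧ L ∈ represented b (matC l)}
  | .real => {L | ∃ m : ℝ, L ∈ represented b (matN m)}

/-- The abstract isomorphism type attached to each normal form. -/
def HasIsoType (G : Type*) [Group G] : FormType → Prop
  | .zero => Nonempty (G ≃* SO1 2)
  | .so2 => Nonempty (G ≃* Matrix.specialOrthogonalGroup (Fin 2) ℝ)
  | .s3 => Nonempty (G ≃* Equiv.Perm (Fin 3))
  | .z3 => Nonempty (G ≃* Multiplicative (ZMod 3))
  | .z2B => Nonempty (G ≃* Multiplicative (ZMod 2))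
  | .z2z2 => Nonempty (G ≃* Multiplicative (ZMod 2) × Multiplicative (ZMod 2))
  | .z2A => Nonempty (G ≃* Multiplicative (ZMod 2))
  | .so11 => Nonempty (G ≃* SO1 1)
  | .real => Nonempty (G ≃* Multiplicative ℝ)

end LorentzCubic

end

/- A stabilizer element is an automorphism of the commutative algebra `(V, K)` preserving `h`. Every
`L ∈ SO(1,2)` has a fixed vector, since the dimension is odd, so in an adapted basis it is a
rotation, a half-turn, a boost or a null rotation; its invariance kills the coefficients of `K` of
nonzero weight, and rescaling or rotating the basis yields one of the normal forms. If all
nontrivial symmetries are half-turns about spacelike axes, two different ones have orthogonal axes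
and their product fixes a timelike vector. In each normal form some basis vector is characterized
by its norm and its square `K(u, u)`, so the stabilizer preserves its line and a comparison of
coefficients determines it. The forms are told apart by the order of the stabilizer and the causal
type of the common axis of its elements. -/
namespace LorentzCubic

variable {V : Type*} [AddCommGroup V] [Module ℝ V]

section Coordinates

variable {b : Module.Basis (Fin 3) ℝ V} {A B : Matrix (Fin 3) (Fin 3) ℝ} {L M : V ≃ₗ[ℝ] V}

theorem exists_coords (b : Module.Basis (Fin 3) ℝ V) (x : V) :
    ∃ p q r : ℝ, x = p • b 0 + q • b 1 + r • b 2 :=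
  ⟨b.repr x 0, b.repr x 1, b.repr x 2, by rw [← Fin.sum_univ_three (fun i => b.repr x i • b i),
    b.sum_repr]⟩

theorem coords_inj {p q r p' q' r' : ℝ} :
    p • b 0 + q • b 1 + r • b 2 = p' • b 0 + q' • b 1 + r' • b 2 ↔
      p = p' ∧ q = q' ∧ r = r' := by
  refine ⟨fun hx => ?_, by rintro ⟨rfl, rfl, rfl⟩; rfl⟩
  have key := DFunLike.congr_fun (congrArg b.repr hx)
  exact ⟨by simpa using key 0, by simpa using key 1, by simpa using key 2⟩

theorem toMatrix_eq_iff (f : V →ₗ[ℝ] V) :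
    LinearMap.toMatrix b b f = A ↔
      ∀ j, f (b j) = A 0 j • b 0 + A 1 j • b 1 + A 2 j • b 2 := by
  rw [← (LinearMap.toMatrix b b).symm.injective.eq_iff, LinearEquiv.symm_apply_apply,
    LinearMap.toMatrix_symm]
  refine ⟨by rintro rfl j; simp [Matrix.toLin_self, Fin.sum_univ_three], fun H => b.ext fun j => ?_⟩
  rw [H, Matrix.toLin_self, Fin.sum_univ_three]

theorem mem_represented_iff :
    L ∈ represented b A ↔ ∀ j, L (b j) = A 0 j • b 0 + A 1 j • b 1 + A 2 j • b 2 :=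
  toMatrix_eq_iff (L : V →ₗ[ℝ] V)

theorem mem_represented_iff_columns :
    L ∈ represented b A ↔ L (b 0) = A 0 0 • b 0 + A 1 0 • b 1 + A 2 0 • b 2 ∧
      L (b 1) = A 0 1 • b 0 + A 1 1 • b 1 + A 2 1 • b 2 ∧
      L (b 2) = A 0 2 • b 0 + A 1 2 • b 1 + A 2 2 • b 2 := by
  rw [mem_represented_iff, Fin.forall_fin_succ, Fin.forall_fin_two]
  rfl

theorem represented_subsingleton (b : Module.Basis (Fin 3) ℝ V) (A : Matrix (Fin 3) (Fin 3) ℝ) :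
    (represented b A).Subsingleton := fun _ hL _ hM =>
  LinearEquiv.toLinearMap_injective ((LinearMap.toMatrix b b).injective (Eq.trans hL hM.symm))

theorem mul_mem_represented (hL : L ∈ represented b A) (hM : M ∈ represented b B) :
    L * M ∈ represented b (A * B) := by
  rw [← show _ = A from hL, ← show _ = B from hM]
  exact LinearMap.toMatrix_mul b _ _

theorem mem_represented_one_iff : L ∈ represented b 1 ↔ L = 1 :=
  ⟨fun hL => represented_subsingleton b 1 hL (LinearMap.toMatrix_id b),
    by rintro rfl; exact LinearMap.toMatrix_id b⟩

theorem exists_mem_represented (b : Module.Basis (Fin 3) ℝ V) (hA : IsUnit A.det) :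
    ∃ L : V ≃ₗ[ℝ] V, L ∈ represented b A :=
  ⟨Matrix.toLinearEquiv b A hA, LinearMap.toMatrix_toLin b b A⟩

theorem det_of_mem_represented (hL : L ∈ represented b A) :
    LinearMap.det (L : V →ₗ[ℝ] V) = A.det := by
  rw [← LinearMap.det_toMatrix b, show LinearMap.toMatrix b b (L : V →ₗ[ℝ] V) = A from hL]

end Coordinates

section Forms

variable {h : BilinForm ℝ V} {b : Module.Basis (Fin 3) ℝ V} {L : V ≃ₗ[ℝ] V}

theorem IsONB.apply_eq (hs : h.IsSymm) (hb : IsONB h b) (p q r p' q' r' : ℝ) :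
    h (p • b 0 + q • b 1 + r • b 2) (p' • b 0 + q' • b 1 + r' • b 2) =
      -(p * p') + q * q' + r * r' := by
  obtain ⟨h00, h11, h22, h01, h02, h12⟩ := hb
  simp [h00, h11, h22, h01, h02, h12, hs.eq (b 0) (b 1) ▸ h01, hs.eq (b 0) (b 2) ▸ h02,
    hs.eq (b 1) (b 2) ▸ h12]

theorem IsLVB.apply_eq (hs : h.IsSymm) (hb : IsLVB h b) (p q r p' q' r' : ℝ) :
    h (p • b 0 + q • b 1 + r • b 2) (p' • b 0 + q' • b 1 + r' • b 2) =
      p * r' + q * q' + r * p' := by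
  obtain ⟨h00, h22, h02, h01, h21, h11⟩ := hb
  simp [h00, h11, h22, h01, h02, h21, hs.eq (b 0) (b 1) ▸ h01, hs.eq (b 0) (b 2) ▸ h02,
    hs.eq (b 2) (b 1) ▸ h21]

theorem IsONB.repr_eq (hs : h.IsSymm) (hb : IsONB h b) (x : V) :
    b.repr x 0 = -h x (b 0) ∧ b.repr x 1 = h x (b 1) ∧ b.repr x 2 = h x (b 2) := by
  obtain ⟨p, q, r, rfl⟩ := exists_coords b x
  obtain ⟨h00, h11, h22, h01, h02, h12⟩ := hb
  simp [h00, h11, h22, h01, h02, h12, hs.eq (b 0) (b 1) ▸ h01, hs.eq (b 0) (b 2) ▸ h02,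
    hs.eq (b 1) (b 2) ▸ h12]

theorem IsLVB.repr_eq (hs : h.IsSymm) (hb : IsLVB h b) (x : V) :
    b.repr x 0 = h x (b 2) ∧ b.repr x 1 = h x (b 1) ∧ b.repr x 2 = h x (b 0) := by
  obtain ⟨p, q, r, rfl⟩ := exists_coords b x
  obtain ⟨h00, h22, h02, h01, h21, h11⟩ := hb
  simp [h00, h11, h22, h01, h02, h21, hs.eq (b 0) (b 1) ▸ h01, hs.eq (b 0) (b 2) ▸ h02,
    hs.eq (b 2) (b 1) ▸ h21]

theorem IsONB.separatingLeft (hs : h.IsSymm) (hb : IsONB h b) : h.SeparatingLeft := by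
  intro x hx
  obtain ⟨h0, h1, h2⟩ := hb.repr_eq hs x
  refine b.ext_elem fun i => ?_
  fin_cases i <;> simp [h0, h1, h2, hx]

theorem IsLVB.separatingLeft (hs : h.IsSymm) (hb : IsLVB h b) : h.SeparatingLeft := by
  intro x hx
  obtain ⟨h0, h1, h2⟩ := hb.repr_eq hs x
  refine b.ext_elem fun i => ?_
  fin_cases i <;> simp [h0, h1, h2, hx]

theorem IsONB.map (hb : IsONB h b) (hL : ∀ x y, h (L x) (L y) = h x y) : IsONB h (b.map L) := by
  simpa only [IsONB, Module.Basis.map_apply, hL] using hb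

theorem IsLVB.map (hb : IsLVB h b) (hL : ∀ x y, h (L x) (L y) = h x y) : IsLVB h (b.map L) := by
  simpa only [IsLVB, Module.Basis.map_apply, hL] using hb

theorem map_coords (b : Module.Basis (Fin 3) ℝ V) (L : V ≃ₗ[ℝ] V) (p q r : ℝ) :
    L (p • b 0 + q • b 1 + r • b 2) = p • b.map L 0 + q • b.map L 1 + r • b.map L 2 := by
  simp only [map_add, map_smul, Module.Basis.map_apply]

theorem IsONB.mem_specialIsometryGroup (hs : h.IsSymm) (hb : IsONB h b)
    (hL : IsONB h (b.map L)) (hdet : LinearMap.det (L : V →ₗ[ℝ] V) = 1) :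
    L ∈ specialIsometryGroup h := by
  refine ⟨fun x y => ?_, hdet⟩
  obtain ⟨p, q, r, rfl⟩ := exists_coords b x
  obtain ⟨p', q', r', rfl⟩ := exists_coords b y
  rw [map_coords, map_coords, hL.apply_eq hs, hb.apply_eq hs]

theorem IsLVB.mem_specialIsometryGroup (hs : h.IsSymm) (hb : IsLVB h b)
    (hL : IsLVB h (b.map L)) (hdet : LinearMap.det (L : V →ₗ[ℝ] V) = 1) :
    L ∈ specialIsometryGroup h := by
  refine ⟨fun x y => ?_, hdet⟩
  obtain ⟨p, q, r, rfl⟩ := exists_coords b x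
  obtain ⟨p', q', r', rfl⟩ := exists_coords b y
  rw [map_coords, map_coords, hL.apply_eq hs, hb.apply_eq hs]

end Forms

section Coefficients

variable {h : BilinForm ℝ V} {K : V →ₗ[ℝ] V →ₗ[ℝ] V} {b : Module.Basis (Fin 3) ℝ V}
  {a₁ a₂ a₃ a₄ a₅ a₆ a₇ : ℝ}

theorem trace_eq_sum (b : Module.Basis (Fin 3) ℝ V) (f : V →ₗ[ℝ] V) :
    LinearMap.trace ℝ V f = b.repr (f (b 0)) 0 + b.repr (f (b 1)) 1 + b.repr (f (b 2)) 2 := by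
  simp only [LinearMap.trace_eq_matrix_trace ℝ b, Matrix.trace_fin_three, LinearMap.toMatrix_apply]

theorem IsTracelessCubic.hasONBCoeffs (hs : h.IsSymm) (hK : IsTracelessCubic h K)
    (hb : IsONB h b) :
    HasONBCoeffs K b (h (K (b 0) (b 0)) (b 0)) (h (K (b 0) (b 0)) (b 1)) (h (K (b 0) (b 0)) (b 2))
      (h (K (b 0) (b 1)) (b 1)) (h (K (b 0) (b 1)) (b 2)) (h (K (b 1) (b 1)) (b 1))
      (h (K (b 1) (b 1)) (b 2)) := by
  obtain ⟨hswap, hperm, htrace⟩ := hK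
  have trace_eq : ∀ i, h (K (b i) (b 2)) (b 2) =
      h (K (b i) (b 0)) (b 0) - h (K (b i) (b 1)) (b 1) := fun i => by
    have := htrace (b i)
    rw [trace_eq_sum b, (hb.repr_eq hs _).1, (hb.repr_eq hs _).2.1, (hb.repr_eq hs _).2.2] at this
    linarith
  have toMatrix_eq : ∀ i, LinearMap.toMatrix b b (K (b i)) = Matrix.of
      ![fun j => -h (K (b i) (b j)) (b 0), fun j => h (K (b i) (b j)) (b 1),
        fun j => h (K (b i) (b j)) (b 2)] := fun i => by
    ext j k
    rw [LinearMap.toMatrix_apply]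
    obtain ⟨h0, h1, h2⟩ := hb.repr_eq hs (K (b i) (b k))
    fin_cases j <;> assumption
  have s10 := hswap (b 1) (b 0)
  have s20 := hswap (b 2) (b 0)
  have s21 := hswap (b 2) (b 1)
  have t010 := hperm (b 0) (b 1) (b 0)
  have t020 := hperm (b 0) (b 2) (b 0)
  have t021 := hperm (b 0) (b 2) (b 1)
  have t110 := hperm (b 1) (b 1) (b 0)
  have t120 := hperm (b 1) (b 2) (b 0)
  have t121 := hperm (b 1) (b 2) (b 1)
  have t220 := hperm (b 2) (b 2) (b 0)
  have t221 := hperm (b 2) (b 2) (b 1)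
  refine ⟨?_, ?_, ?_⟩ <;> rw [toMatrix_eq] <;> ext j k <;> fin_cases j <;> fin_cases k <;>
    simp [s10, s20, s21, t010, t020, t021, t110, t120, t121, t220, t221, trace_eq]

theorem IsTracelessCubic.hasLVBCoeffs (hs : h.IsSymm) (hK : IsTracelessCubic h K)
    (hb : IsLVB h b) :
    HasLVBCoeffs K b (h (K (b 0) (b 0)) (b 2)) (h (K (b 0) (b 0)) (b 1)) (h (K (b 0) (b 0)) (b 0))
      (h (K (b 0) (b 1)) (b 2)) (h (K (b 0) (b 2)) (b 2)) (h (K (b 1) (b 2)) (b 2))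
      (h (K (b 2) (b 2)) (b 2)) := by
  obtain ⟨hswap, hperm, htrace⟩ := hK
  have trace_eq : ∀ i, h (K (b i) (b 1)) (b 1) = -(2 * h (K (b i) (b 0)) (b 2)) := fun i => by
    have := htrace (b i)
    rw [trace_eq_sum b, (hb.repr_eq hs _).1, (hb.repr_eq hs _).2.1, (hb.repr_eq hs _).2.2,
      hperm (b i) (b 2) (b 0)] at this
    linarith
  have toMatrix_eq : ∀ i, LinearMap.toMatrix b b (K (b i)) = Matrix.of
      ![fun j => h (K (b i) (b j)) (b 2), fun j => h (K (b i) (b j)) (b 1),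
        fun j => h (K (b i) (b j)) (b 0)] := fun i => by
    ext j k
    rw [LinearMap.toMatrix_apply]
    obtain ⟨h0, h1, h2⟩ := hb.repr_eq hs (K (b i) (b k))
    fin_cases j <;> assumption
  have s10 := hswap (b 1) (b 0)
  have s20 := hswap (b 2) (b 0)
  have s21 := hswap (b 2) (b 1)
  have t010 := hperm (b 0) (b 1) (b 0)
  have t020 := hperm (b 0) (b 2) (b 0)
  have t021 := hperm (b 0) (b 2) (b 1)
  have t110 := hperm (b 1) (b 1) (b 0)
  have t112 := hperm (b 1) (b 1) (b 2)
  have t120 := hperm (b 1) (b 2) (b 0)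
  have t121 : h (K (b 1) (b 2)) (b 1) = -(2 * h (K (b 0) (b 2)) (b 2)) := by
    rw [hswap, trace_eq, hswap (b 2)]
  have t220 := hperm (b 2) (b 2) (b 0)
  have t221 := hperm (b 2) (b 2) (b 1)
  refine ⟨?_, ?_, ?_⟩ <;> rw [toMatrix_eq] <;> ext j k <;> fin_cases j <;> fin_cases k <;>
    simp [s10, s20, s21, t010, t020, t021, t110, t112, t121, t120, t220, t221, trace_eq]

theorem HasONBCoeffs.unique {a₁' a₂' a₃' a₄' a₅' a₆' a₇' : ℝ}
    (ha : HasONBCoeffs K b a₁ a₂ a₃ a₄ a₅ a₆ a₇)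
    (ha' : HasONBCoeffs K b a₁' a₂' a₃' a₄' a₅' a₆' a₇') :
    a₁ = a₁' ∧ a₂ = a₂' ∧ a₃ = a₃' ∧ a₄ = a₄' ∧ a₅ = a₅' ∧ a₆ = a₆' ∧ a₇ = a₇' := by
  have e0 := fun i j => congrFun₂ (ha.1.symm.trans ha'.1) i j
  have e1 := fun i j => congrFun₂ (ha.2.1.symm.trans ha'.2.1) i j
  exact ⟨neg_injective (e0 0 0), e0 1 0, e0 2 0, e0 1 1, e0 1 2, e1 1 1, e1 1 2⟩

theorem HasLVBCoeffs.unique {b₁ b₂ b₃ b₄ b₅ b₆ b₇ b₁' b₂' b₃' b₄' b₅' b₆' b₇' : ℝ}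
    (hb : HasLVBCoeffs K b b₁ b₂ b₃ b₄ b₅ b₆ b₇)
    (hb' : HasLVBCoeffs K b b₁' b₂' b₃' b₄' b₅' b₆' b₇') :
    b₁ = b₁' ∧ b₂ = b₂' ∧ b₃ = b₃' ∧ b₄ = b₄' ∧ b₅ = b₅' ∧ b₆ = b₆' ∧ b₇ = b₇' := by
  have e0 := fun i j => congrFun₂ (hb.1.symm.trans hb'.1) i j
  have e2 := fun i j => congrFun₂ (hb.2.2.symm.trans hb'.2.2) i j
  exact ⟨e0 0 0, e0 1 0, e0 2 0, e0 0 1, e0 0 2, e2 0 1, e2 0 2⟩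

theorem HasONBCoeffs.apply_eq (ha : HasONBCoeffs K b a₁ a₂ a₃ a₄ a₅ a₆ a₇)
    (p q r p' q' r' : ℝ) :
    K (p • b 0 + q • b 1 + r • b 2) (p' • b 0 + q' • b 1 + r' • b 2) =
      (-(a₁ * (p * p') + a₂ * (p * q' + q * p') + a₃ * (p * r' + r * p') + a₄ * (q * q') +
        a₅ * (q * r' + r * q') + (a₁ - a₄) * (r * r'))) • b 0 +
      (a₂ * (p * p') + a₄ * (p * q' + q * p') + a₅ * (p * r' + r * p') + a₆ * (q * q') +
        a₇ * (q * r' + r * q') + (a₂ - a₆) * (r * r')) • b 1 +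
      (a₃ * (p * p') + a₅ * (p * q' + q * p') + (a₁ - a₄) * (p * r' + r * p') + a₇ * (q * q') +
        (a₂ - a₆) * (q * r' + r * q') + (a₃ - a₇) * (r * r')) • b 2 := by
  simp only [HasONBCoeffs, toMatrix_eq_iff, Fin.forall_fin_succ, IsEmpty.forall_iff, and_true,
    Fin.succ_zero_eq_one, Fin.succ_one_eq_two] at ha
  simp only [map_add, map_smul, LinearMap.add_apply, LinearMap.smul_apply, ha, Matrix.of_apply,
    Matrix.cons_val]
  module

theorem HasLVBCoeffs.apply_eq {b₁ b₂ b₃ b₄ b₅ b₆ b₇ : ℝ}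
    (hb : HasLVBCoeffs K b b₁ b₂ b₃ b₄ b₅ b₆ b₇) (p q r p' q' r' : ℝ) :
    K (p • b 0 + q • b 1 + r • b 2) (p' • b 0 + q' • b 1 + r' • b 2) =
      (b₁ * (p * p') + b₄ * (p * q' + q * p') + b₅ * (p * r' + r * p') - 2 * b₅ * (q * q') +
        b₆ * (q * r' + r * q') + b₇ * (r * r')) • b 0 +
      (b₂ * (p * p') - 2 * b₁ * (p * q' + q * p') + b₄ * (p * r' + r * p') -
        2 * b₄ * (q * q') - 2 * b₅ * (q * r' + r * q') + b₆ * (r * r')) • b 1 +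
      (b₃ * (p * p') + b₂ * (p * q' + q * p') + b₁ * (p * r' + r * p') - 2 * b₁ * (q * q') +
        b₄ * (q * r' + r * q') + b₅ * (r * r')) • b 2 := by
  simp only [HasLVBCoeffs, toMatrix_eq_iff, Fin.forall_fin_succ, IsEmpty.forall_iff, and_true,
    Fin.succ_zero_eq_one, Fin.succ_one_eq_two] at hb
  simp only [map_add, map_smul, LinearMap.add_apply, LinearMap.smul_apply, hb, Matrix.of_apply,
    Matrix.cons_val]
  module

end Coefficients

section Stabilizer

variable {h : BilinForm ℝ V} {K : V →ₗ[ℝ] V →ₗ[ℝ] V} {b : Module.Basis (Fin 3) ℝ V}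
  {L : V ≃ₗ[ℝ] V} {a₁ a₂ a₃ a₄ a₅ a₆ a₇ : ℝ}

theorem map_apply_of_mem_cubicStabilizer (hnd : h.SeparatingLeft)
    (hL : L ∈ cubicStabilizer h K) (x y : V) : K (L x) (L y) = L (K x y) := by
  obtain ⟨⟨hiso, -⟩, hinv⟩ := hL
  refine sub_eq_zero.1 (hnd _ fun z => ?_)
  obtain ⟨z, rfl⟩ := L.surjective z
  rw [map_sub, LinearMap.sub_apply, hinv, hiso, sub_self]

theorem IsONB.mem_cubicStabilizer_iff (hs : h.IsSymm) (hK : IsTracelessCubic h K)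
    (hb : IsONB h b) (ha : HasONBCoeffs K b a₁ a₂ a₃ a₄ a₅ a₆ a₇)
    (hL : L ∈ specialIsometryGroup h) :
    L ∈ cubicStabilizer h K ↔ HasONBCoeffs K (b.map L) a₁ a₂ a₃ a₄ a₅ a₆ a₇ := by
  refine ⟨fun hstab => ?_, fun hLa => ⟨hL, fun x y z => ?_⟩⟩
  · obtain ⟨rfl, rfl, rfl, rfl, rfl, rfl, rfl⟩ := ha.unique (hK.hasONBCoeffs hs hb)
    simpa only [Module.Basis.map_apply, hstab.2] using hK.hasONBCoeffs hs (hb.map hL.1)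
  · obtain ⟨p, q, r, rfl⟩ := exists_coords b x
    obtain ⟨p', q', r', rfl⟩ := exists_coords b y
    obtain ⟨p'', q'', r'', rfl⟩ := exists_coords b z
    rw [map_coords, map_coords, map_coords, hLa.apply_eq, ha.apply_eq, hb.apply_eq hs,
      (hb.map hL.1).apply_eq hs]

theorem IsLVB.mem_cubicStabilizer_iff (hs : h.IsSymm) (hK : IsTracelessCubic h K)
    (hb : IsLVB h b) {b₁ b₂ b₃ b₄ b₅ b₆ b₇ : ℝ} (hc : HasLVBCoeffs K b b₁ b₂ b₃ b₄ b₅ b₆ b₇)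
    (hL : L ∈ specialIsometryGroup h) :
    L ∈ cubicStabilizer h K ↔ HasLVBCoeffs K (b.map L) b₁ b₂ b₃ b₄ b₅ b₆ b₇ := by
  refine ⟨fun hstab => ?_, fun hLc => ⟨hL, fun x y z => ?_⟩⟩
  · obtain ⟨rfl, rfl, rfl, rfl, rfl, rfl, rfl⟩ := hc.unique (hK.hasLVBCoeffs hs hb)
    simpa only [Module.Basis.map_apply, hstab.2] using hK.hasLVBCoeffs hs (hb.map hL.1)
  · obtain ⟨p, q, r, rfl⟩ := exists_coords b x
    obtain ⟨p', q', r', rfl⟩ := exists_coords b y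
    obtain ⟨p'', q'', r'', rfl⟩ := exists_coords b z
    rw [map_coords, map_coords, map_coords, hLc.apply_eq, hc.apply_eq, hb.apply_eq hs,
      (hb.map hL.1).apply_eq hs]

end Stabilizer

section Axial

variable {h : BilinForm ℝ V} {K : V →ₗ[ℝ] V →ₗ[ℝ] V} {b : Module.Basis (Fin 3) ℝ V}
  {L : V ≃ₗ[ℝ] V} {a₁ a₂ a₃ a₄ a₅ a₆ a₇ ε c s : ℝ}

/-- The special isometries preserving the timelike axis of an orthonormal basis: for `ε = 1` the
rotation with cosine `c` and sine `s`, for `ε = -1` this rotation composed with the half-turn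
`matB`. -/
def axialMat (ε c s : ℝ) : Matrix (Fin 3) (Fin 3) ℝ := !![ε, 0, 0; 0, c, -(ε * s); 0, s, ε * c]

theorem matA_eq_axialMat (θ : ℝ) : matA θ = axialMat 1 (Real.cos θ) (Real.sin θ) := by
  simp [matA, axialMat]

theorem matB_eq_axialMat : matB = axialMat (-1) 1 0 := by
  simp [matB, axialMat]

theorem mem_represented_axialMat_iff :
    L ∈ represented b (axialMat ε c s) ↔ L (b 0) = ε • b 0 + (0 : ℝ) • b 1 + (0 : ℝ) • b 2 ∧
      L (b 1) = (0 : ℝ) • b 0 + c • b 1 + s • b 2 ∧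
      L (b 2) = (0 : ℝ) • b 0 + (-(ε * s)) • b 1 + (ε * c) • b 2 :=
  mem_represented_iff_columns

theorem det_axialMat (hε : ε ^ 2 = 1) (hcs : c ^ 2 + s ^ 2 = 1) : (axialMat ε c s).det = 1 := by
  simp only [axialMat, Matrix.det_fin_three, Matrix.of_apply, Matrix.cons_val]
  linear_combination hcs * ε ^ 2 + hε

theorem exists_mem_represented_axialMat (b : Module.Basis (Fin 3) ℝ V) (hε : ε ^ 2 = 1)
    (hcs : c ^ 2 + s ^ 2 = 1) : ∃ L : V ≃ₗ[ℝ] V, L ∈ represented b (axialMat ε c s) :=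
  exists_mem_represented b (by rw [det_axialMat hε hcs]; exact isUnit_one)

theorem IsONB.mem_specialIsometryGroup_of_axial (hs : h.IsSymm) (hb : IsONB h b)
    (hε : ε ^ 2 = 1) (hcs : c ^ 2 + s ^ 2 = 1) (hL : L ∈ represented b (axialMat ε c s)) :
    L ∈ specialIsometryGroup h := by
  refine hb.mem_specialIsometryGroup hs ?_ ((det_of_mem_represented hL).trans (det_axialMat hε hcs))
  obtain ⟨h0, h1, h2⟩ := mem_represented_axialMat_iff.1 hL
  simp only [IsONB, Module.Basis.map_apply, h0, h1, h2, hb.apply_eq hs]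
  refine ⟨?_, ?_, ?_, ?_, ?_, ?_⟩ <;> grind

theorem IsONB.exists_axial_of_apply_timelike_eq_smul (hs : h.IsSymm) (hb : IsONB h b)
    (hL : L ∈ specialIsometryGroup h) (h0 : L (b 0) = ε • b 0) :
    ∃ c s, ε ^ 2 = 1 ∧ c ^ 2 + s ^ 2 = 1 ∧ L ∈ represented b (axialMat ε c s) := by
  obtain ⟨p, c, s, h1⟩ := exists_coords b (L (b 1))
  obtain ⟨p', c', s', h2⟩ := exists_coords b (L (b 2))
  replace h0 : L (b 0) = ε • b 0 + (0 : ℝ) • b 1 + (0 : ℝ) • b 2 := by simp [h0]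
  have hdet : ε * (c * s' - s * c') = 1 := by
    have hmem : L ∈ represented b !![ε, p, p'; 0, c, c'; 0, s, s'] :=
      mem_represented_iff_columns.2 ⟨h0, h1, h2⟩
    rw [← hL.2, det_of_mem_represented hmem]
    simp only [Matrix.det_fin_three, Matrix.of_apply, Matrix.cons_val]
    ring
  obtain ⟨e00, e11, e22, e01, e02, e12⟩ := hb.map hL.1
  simp only [Module.Basis.map_apply, h0, h1, h2, hb.apply_eq hs] at e00 e11 e22 e01 e02 e12
  have hε : ε ^ 2 = 1 := by linarith
  have hp : p = 0 := by linear_combination -ε * e01 - p * hε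
  have hp' : p' = 0 := by linear_combination -ε * e02 - p' * hε
  subst hp hp'
  have hcs : c ^ 2 + s ^ 2 = 1 := by linarith
  refine ⟨c, s, hε, hcs, mem_represented_axialMat_iff.2 ⟨h0, h1, ?_⟩⟩
  rw [h2, coords_inj]
  exact ⟨rfl, by grind, by grind⟩

theorem IsONB.axial_coeffs (hs : h.IsSymm) (hK : IsTracelessCubic h K) (hb : IsONB h b)
    (ha : HasONBCoeffs K b a₁ a₂ a₃ a₄ a₅ a₆ a₇) (hε : ε ^ 2 = 1) (hcs : c ^ 2 + s ^ 2 = 1)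
    (hL : L ∈ represented b (axialMat ε c s)) :
    HasONBCoeffs K (b.map L) (ε * a₁) (c * a₂ + s * a₃) (ε * (c * a₃ - s * a₂))
      (ε * (c ^ 2 * a₄ + 2 * c * s * a₅ + s ^ 2 * (a₁ - a₄)))
      ((c ^ 2 - s ^ 2) * a₅ + c * s * (a₁ - 2 * a₄))
      (c ^ 3 * a₆ + 3 * c ^ 2 * s * a₇ + 3 * c * s ^ 2 * (a₂ - a₆) + s ^ 3 * (a₃ - a₇))
      (ε * (-(c ^ 2 * s * a₆) + (c ^ 3 - 2 * c * s ^ 2) * a₇ +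
        (2 * c ^ 2 * s - s ^ 3) * (a₂ - a₆) + s ^ 2 * c * (a₃ - a₇))) := by
  have hiso := (hb.mem_specialIsometryGroup_of_axial hs hε hcs hL).1
  obtain ⟨h0, h1, h2⟩ := mem_represented_axialMat_iff.1 hL
  convert hK.hasONBCoeffs hs (hb.map hiso) using 1 <;>
    simp only [Module.Basis.map_apply, h0, h1, h2, ha.apply_eq, hb.apply_eq hs]
  · linear_combination -(ε * a₁) * hε
  · linear_combination -(c * a₂ + s * a₃) * hε
  · linear_combination -(ε * (c * a₃ - s * a₂)) * hε
  · ring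
  · linear_combination -((c ^ 2 - s ^ 2) * a₅ + c * s * (a₁ - 2 * a₄)) * hε
  · ring
  · ring

theorem IsONB.mem_cubicStabilizer_iff_of_axial (hs : h.IsSymm) (hK : IsTracelessCubic h K)
    (hb : IsONB h b) (ha : HasONBCoeffs K b a₁ a₂ a₃ a₄ a₅ a₆ a₇) (hε : ε ^ 2 = 1)
    (hcs : c ^ 2 + s ^ 2 = 1) (hL : L ∈ represented b (axialMat ε c s)) :
    L ∈ cubicStabilizer h K ↔ ε * a₁ = a₁ ∧ c * a₂ + s * a₃ = a₂ ∧ ε * (c * a₃ - s * a₂) = a₃ ∧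
      ε * (c ^ 2 * a₄ + 2 * c * s * a₅ + s ^ 2 * (a₁ - a₄)) = a₄ ∧
      (c ^ 2 - s ^ 2) * a₅ + c * s * (a₁ - 2 * a₄) = a₅ ∧
      c ^ 3 * a₆ + 3 * c ^ 2 * s * a₇ + 3 * c * s ^ 2 * (a₂ - a₆) + s ^ 3 * (a₃ - a₇) = a₆ ∧
      ε * (-(c ^ 2 * s * a₆) + (c ^ 3 - 2 * c * s ^ 2) * a₇ +
        (2 * c ^ 2 * s - s ^ 3) * (a₂ - a₆) + s ^ 2 * c * (a₃ - a₇)) = a₇ := by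
  have hLa := hb.axial_coeffs hs hK ha hε hcs hL
  rw [hb.mem_cubicStabilizer_iff hs hK ha (hb.mem_specialIsometryGroup_of_axial hs hε hcs hL)]
  refine ⟨hLa.unique, fun heq => ?_⟩
  obtain ⟨e1, e2, e3, e4, e5, e6, e7⟩ := heq
  rwa [e1, e2, e3, e4, e5, e6, e7] at hLa

end Axial

section LightVectorBasis

variable {h : BilinForm ℝ V} {K : V →ₗ[ℝ] V →ₗ[ℝ] V} {b : Module.Basis (Fin 3) ℝ V}
  {L : V ≃ₗ[ℝ] V} {b₁ b₂ b₃ b₄ b₅ b₆ b₇ l m : ℝ}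

theorem mem_represented_matC_iff :
    L ∈ represented b (matC l) ↔ L (b 0) = l • b 0 + (0 : ℝ) • b 1 + (0 : ℝ) • b 2 ∧
      L (b 1) = (0 : ℝ) • b 0 + (1 : ℝ) • b 1 + (0 : ℝ) • b 2 ∧
      L (b 2) = (0 : ℝ) • b 0 + (0 : ℝ) • b 1 + (1 / l) • b 2 :=
  mem_represented_iff_columns

theorem mem_represented_matN_iff :
    L ∈ represented b (matN m) ↔ L (b 0) = (1 : ℝ) • b 0 + (0 : ℝ) • b 1 + (0 : ℝ) • b 2 ∧
      L (b 1) = (-m) • b 0 + (1 : ℝ) • b 1 + (0 : ℝ) • b 2 ∧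
      L (b 2) = (-(m ^ 2 / 2)) • b 0 + m • b 1 + (1 : ℝ) • b 2 :=
  mem_represented_iff_columns

theorem matC_one : matC 1 = 1 := by
  simp [matC, Matrix.one_fin_three]

theorem matN_zero : matN 0 = 1 := by
  simp [matN, Matrix.one_fin_three]

theorem det_matC (hl : l ≠ 0) : (matC l).det = 1 := by
  simp [matC, Matrix.det_fin_three, hl]

theorem det_matN (m : ℝ) : (matN m).det = 1 := by
  simp [matN, Matrix.det_fin_three]

theorem IsLVB.mem_specialIsometryGroup_of_matC (hs : h.IsSymm) (hb : IsLVB h b) (hl : l ≠ 0)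
    (hL : L ∈ represented b (matC l)) : L ∈ specialIsometryGroup h := by
  refine hb.mem_specialIsometryGroup hs ?_ ((det_of_mem_represented hL).trans (det_matC hl))
  obtain ⟨h0, h1, h2⟩ := mem_represented_matC_iff.1 hL
  simp only [IsLVB, Module.Basis.map_apply, h0, h1, h2, hb.apply_eq hs]
  refine ⟨?_, ?_, ?_, ?_, ?_, ?_⟩ <;> field_simp <;> ring

theorem IsLVB.mem_specialIsometryGroup_of_matN (hs : h.IsSymm) (hb : IsLVB h b)
    (hL : L ∈ represented b (matN m)) : L ∈ specialIsometryGroup h := by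
  refine hb.mem_specialIsometryGroup hs ?_ ((det_of_mem_represented hL).trans (det_matN m))
  obtain ⟨h0, h1, h2⟩ := mem_represented_matN_iff.1 hL
  simp only [IsLVB, Module.Basis.map_apply, h0, h1, h2, hb.apply_eq hs]
  refine ⟨?_, ?_, ?_, ?_, ?_, ?_⟩ <;> ring

theorem IsLVB.exists_matC_of_apply_spacelike_eq (hs : h.IsSymm) (hb : IsLVB h b)
    (hL : L ∈ specialIsometryGroup h) (h1 : L (b 1) = b 1) :
    ∃ l, l ≠ 0 ∧ L ∈ represented b (matC l) := by
  obtain ⟨p, q, r, h0⟩ := exists_coords b (L (b 0))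
  obtain ⟨p', q', r', h2⟩ := exists_coords b (L (b 2))
  replace h1 : L (b 1) = (0 : ℝ) • b 0 + (1 : ℝ) • b 1 + (0 : ℝ) • b 2 := by simp [h1]
  have hdet : p * r' - r * p' = 1 := by
    have hmem : L ∈ represented b !![p, 0, p'; q, 1, q'; r, 0, r'] :=
      mem_represented_iff_columns.2 ⟨h0, h1, h2⟩
    rw [← hL.2, det_of_mem_represented hmem]
    simp only [Matrix.det_fin_three, Matrix.of_apply, Matrix.cons_val]
    ring
  obtain ⟨e00, e22, e02, e01, e21, -⟩ := hb.map hL.1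
  simp only [Module.Basis.map_apply, h0, h1, h2, hb.apply_eq hs] at e00 e22 e02 e01 e21
  have hq : q = 0 := by linarith
  have hq' : q' = 0 := by linarith
  subst hq hq'
  have hpr' : p * r' = 1 := by linarith
  have hp : p ≠ 0 := left_ne_zero_of_mul_eq_one hpr'
  have hr' : r' ≠ 0 := right_ne_zero_of_mul_eq_one hpr'
  have hr : r = 0 := (mul_eq_zero.1 (by linarith : p * r = 0)).resolve_left hp
  have hp' : p' = 0 := (mul_eq_zero.1 (by linarith : p' * r' = 0)).resolve_right hr'
  subst hr hp'
  refine ⟨p, hp, mem_represented_matC_iff.2 ⟨h0, h1, ?_⟩⟩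
  rw [h2, eq_one_div_of_mul_eq_one_right hpr']

theorem IsLVB.exists_matN_of_apply_lightlike_eq (hs : h.IsSymm) (hb : IsLVB h b)
    (hL : L ∈ specialIsometryGroup h) (h0 : L (b 0) = b 0) :
    ∃ m, L ∈ represented b (matN m) := by
  obtain ⟨p, q, r, h1⟩ := exists_coords b (L (b 1))
  obtain ⟨p', m, r', h2⟩ := exists_coords b (L (b 2))
  replace h0 : L (b 0) = (1 : ℝ) • b 0 + (0 : ℝ) • b 1 + (0 : ℝ) • b 2 := by simp [h0]
  have hdet : q * r' - r * m = 1 := by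
    have hmem : L ∈ represented b !![1, p, p'; 0, q, m; 0, r, r'] :=
      mem_represented_iff_columns.2 ⟨h0, h1, h2⟩
    rw [← hL.2, det_of_mem_represented hmem]
    simp only [Matrix.det_fin_three, Matrix.of_apply, Matrix.cons_val]
    ring
  obtain ⟨-, e22, e02, e01, e21, -⟩ := hb.map hL.1
  simp only [Module.Basis.map_apply, h0, h1, h2, hb.apply_eq hs] at e22 e02 e01 e21
  have hr : r = 0 := by linarith
  have hr' : r' = 1 := by linarith
  subst hr hr'
  have hq : q = 1 := by linarith
  subst hq
  refine ⟨m, mem_represented_matN_iff.2 ⟨h0, ?_, ?_⟩⟩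
  · rw [h1, show p = -m by linarith]
  · rw [h2, show p' = -(m ^ 2 / 2) by linarith]

theorem IsLVB.matC_coeffs (hs : h.IsSymm) (hK : IsTracelessCubic h K) (hb : IsLVB h b)
    (hc : HasLVBCoeffs K b b₁ b₂ b₃ b₄ b₅ b₆ b₇) (hl : l ≠ 0)
    (hL : L ∈ represented b (matC l)) :
    HasLVBCoeffs K (b.map L) (l * b₁) (l ^ 2 * b₂) (l ^ 3 * b₃) b₄ (b₅ / l) (b₆ / l ^ 2)
      (b₇ / l ^ 3) := by
  have hiso := (hb.mem_specialIsometryGroup_of_matC hs hl hL).1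
  obtain ⟨h0, h1, h2⟩ := mem_represented_matC_iff.1 hL
  convert hK.hasLVBCoeffs hs (hb.map hiso) using 1 <;>
    simp only [Module.Basis.map_apply, h0, h1, h2, hc.apply_eq, hb.apply_eq hs] <;>
    field_simp <;> ring

theorem IsLVB.matN_coeffs (hs : h.IsSymm) (hK : IsTracelessCubic h K) (hb : IsLVB h b)
    (hc : HasLVBCoeffs K b b₁ b₂ b₃ b₄ b₅ b₆ b₇) (hL : L ∈ represented b (matN m)) :
    HasLVBCoeffs K (b.map L) (b₁ + m * b₂ - m ^ 2 / 2 * b₃) (b₂ - m * b₃) b₃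
      (b₄ - 3 * m * b₁ - 3 / 2 * m ^ 2 * b₂ + m ^ 3 / 2 * b₃)
      (b₅ + 2 * m * b₄ - 3 * m ^ 2 * b₁ - m ^ 3 * b₂ + m ^ 4 / 4 * b₃)
      (b₆ - 5 * m * b₅ - 5 * m ^ 2 * b₄ + 5 * m ^ 3 * b₁ + 5 / 4 * m ^ 4 * b₂ - m ^ 5 / 4 * b₃)
      (b₇ + 3 * m * b₆ - 15 / 2 * m ^ 2 * b₅ - 5 * m ^ 3 * b₄ + 15 / 4 * m ^ 4 * b₁ +
        3 / 4 * m ^ 5 * b₂ - m ^ 6 / 8 * b₃) := by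
  have hiso := (hb.mem_specialIsometryGroup_of_matN hs hL).1
  obtain ⟨h0, h1, h2⟩ := mem_represented_matN_iff.1 hL
  convert hK.hasLVBCoeffs hs (hb.map hiso) using 1 <;>
    simp only [Module.Basis.map_apply, h0, h1, h2, hc.apply_eq, hb.apply_eq hs] <;> ring

theorem IsLVB.neg_coeffs (hs : h.IsSymm) (hK : IsTracelessCubic h K) (hb : IsLVB h b)
    (hc : HasLVBCoeffs K b b₁ b₂ b₃ b₄ b₅ b₆ b₇) :
    HasLVBCoeffs K (b.map (LinearEquiv.neg ℝ)) (-b₁) (-b₂) (-b₃) (-b₄) (-b₅) (-b₆) (-b₇) := by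
  obtain ⟨rfl, rfl, rfl, rfl, rfl, rfl, rfl⟩ := hc.unique (hK.hasLVBCoeffs hs hb)
  have hneg := hK.hasLVBCoeffs hs (hb.map (L := LinearEquiv.neg ℝ) fun x y => by simp)
  simpa using hneg

end LightVectorBasis

section Angles

theorem exists_polar (n : ℕ) [NeZero n] (x y : ℝ) :
    ∃ r θ : ℝ, 0 ≤ r ∧ x = r * Real.cos (n * θ) ∧ y = r * Real.sin (n * θ) := by
  have hn : (n : ℝ) ≠ 0 := NeZero.ne _
  refine ⟨‖(⟨x, y⟩ : ℂ)‖, Complex.arg ⟨x, y⟩ / n, norm_nonneg _, ?_, ?_⟩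
  · rw [mul_div_cancel₀ _ hn, Complex.norm_mul_cos_arg]
  · rw [mul_div_cancel₀ _ hn, Complex.norm_mul_sin_arg]

theorem exists_cos_eq_and_sin_eq {c s : ℝ} (hcs : c ^ 2 + s ^ 2 = 1) :
    ∃ θ : ℝ, Real.cos θ = c ∧ Real.sin θ = s := by
  obtain ⟨r, θ, hr, rfl, rfl⟩ := exists_polar 1 c s
  have hr' : r = 1 := (pow_eq_one_iff_of_nonneg hr two_ne_zero).1 <| by
    linear_combination hcs - r ^ 2 * Real.cos_sq_add_sin_sq ((1 : ℕ) * θ)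
  exact ⟨(1 : ℕ) * θ, by simp [hr'], by simp [hr']⟩

theorem cos_two_pi_div_three : Real.cos (2 * Real.pi / 3) = -1 / 2 := by
  rw [show 2 * Real.pi / 3 = Real.pi - Real.pi / 3 by ring, Real.cos_pi_sub, Real.cos_pi_div_three]
  norm_num

theorem sin_two_pi_div_three : Real.sin (2 * Real.pi / 3) = √3 / 2 := by
  rw [show 2 * Real.pi / 3 = Real.pi - Real.pi / 3 by ring, Real.sin_pi_sub, Real.sin_pi_div_three]

theorem eq_cube_root_of_unity {c s : ℝ} (hcs : c ^ 2 + s ^ 2 = 1)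
    (hcube : c ^ 3 - 3 * c * s ^ 2 = 1) :
    (c = 1 ∧ s = 0) ∨ (c = -1 / 2 ∧ s = √3 / 2) ∨ (c = -1 / 2 ∧ s = -(√3 / 2)) := by
  have hfactor : (c - 1) * (2 * c + 1) ^ 2 = 0 := by linear_combination hcube + 3 * c * hcs
  rcases mul_eq_zero.1 hfactor with hc | hc
  · obtain rfl : c = 1 := by linarith
    exact Or.inl ⟨rfl, by nlinarith⟩
  · obtain rfl : c = -1 / 2 := by linarith [pow_eq_zero_iff two_ne_zero |>.1 hc]
    have hsq : s ^ 2 = (√3 / 2) ^ 2 := by rw [div_pow, Real.sq_sqrt three_pos.le]; linarith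
    exact Or.inr ((sq_eq_sq_iff_eq_or_eq_neg.1 hsq).imp (⟨rfl, ·⟩) (⟨rfl, ·⟩))

end Angles

section AxialGroups

variable {b : Module.Basis (Fin 3) ℝ V} {L : V ≃ₗ[ℝ] V} {ε c s : ℝ}

theorem matA_two_pi_div_three_eq_axialMat :
    matA (2 * Real.pi / 3) = axialMat 1 (-1 / 2) (√3 / 2) := by
  rw [matA_eq_axialMat, cos_two_pi_div_three, sin_two_pi_div_three]

theorem matA_pi_eq_axialMat : matA Real.pi = axialMat 1 (-1) 0 := by
  rw [matA_eq_axialMat, Real.cos_pi, Real.sin_pi]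

theorem axialMat_one_one_zero : axialMat 1 1 0 = 1 := by
  simp [axialMat, Matrix.one_fin_three]

theorem axialMat_mul (hε : ε ^ 2 = 1) (ε' c s c' s' : ℝ) :
    axialMat ε c s * axialMat ε' c' s' =
      axialMat (ε * ε') (c * c' - ε * (s * s')) (s * c' + ε * (c * s')) := by
  ext i j
  fin_cases i <;> fin_cases j <;>
    simp [axialMat, Matrix.mul_apply, Fin.sum_univ_three] <;> grind

theorem mem_represented_axialMat_one_iff :
    L ∈ represented b (axialMat 1 1 0) ↔ L = 1 := by
  rw [axialMat_one_one_zero, mem_represented_one_iff]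

theorem mem_closure_matA_of_cube_eq_one (hcs : c ^ 2 + s ^ 2 = 1)
    (hcube : c ^ 3 - 3 * c * s ^ 2 = 1) (hL : L ∈ represented b (axialMat 1 c s)) :
    L ∈ Subgroup.closure (represented b (matA (2 * Real.pi / 3))) := by
  rcases eq_cube_root_of_unity hcs hcube with ⟨rfl, rfl⟩ | ⟨rfl, rfl⟩ | ⟨rfl, rfl⟩
  · rw [mem_represented_axialMat_one_iff.1 hL]
    exact one_mem _
  · exact Subgroup.subset_closure (matA_two_pi_div_three_eq_axialMat ▸ hL)
  · obtain ⟨R, hR⟩ := exists_mem_represented_axialMat b (ε := 1) (c := -1 / 2) (s := √3 / 2)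
      (one_pow 2) (by simpa only [neg_sq] using hcs)
    have hRR := mul_mem_represented hR hR
    rw [axialMat_mul (one_pow 2), show -1 / 2 * (-1 / 2) - 1 * (√3 / 2 * (√3 / 2)) = -1 / 2 by
      nlinarith [Real.mul_self_sqrt three_pos.le], one_mul,
      show √3 / 2 * (-1 / 2) + 1 * (-1 / 2 * (√3 / 2)) = -(√3 / 2) by ring] at hRR
    rw [represented_subsingleton b _ hL hRR]
    rw [← matA_two_pi_div_three_eq_axialMat] at hR
    exact mul_mem (Subgroup.subset_closure hR) (Subgroup.subset_closure hR)

theorem mem_closure_matA_pi (hc : c ^ 2 = 1) (hL : L ∈ represented b (axialMat 1 c 0)) :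
    L ∈ Subgroup.closure (represented b (matA Real.pi)) := by
  rcases sq_eq_one_iff.1 hc with rfl | rfl
  · rw [mem_represented_axialMat_one_iff.1 hL]
    exact one_mem _
  · exact Subgroup.subset_closure (matA_pi_eq_axialMat ▸ hL)

theorem mem_closure_union_matB {S : Set (V ≃ₗ[ℝ] V)} (hε : ε ^ 2 = 1) (hcs : c ^ 2 + s ^ 2 = 1)
    (hS : ∀ M ∈ represented b (axialMat 1 c s), M ∈ Subgroup.closure S)
    (hL : L ∈ represented b (axialMat ε c s)) :
    L ∈ Subgroup.closure (S ∪ represented b matB) := by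
  have hle : Subgroup.closure S ≤ Subgroup.closure (S ∪ represented b matB) :=
    Subgroup.closure_mono Set.subset_union_left
  rcases sq_eq_one_iff.1 hε with rfl | rfl
  · exact hle (hS L hL)
  · obtain ⟨M, hM⟩ := exists_mem_represented_axialMat b (one_pow 2) hcs
    obtain ⟨B, hB⟩ := exists_mem_represented_axialMat b (ε := -1) (c := 1) (s := 0)
      (by norm_num) (by norm_num)
    have hMB := mul_mem_represented hM hB
    simp only [axialMat_mul (one_pow 2), one_mul, mul_one, mul_zero, sub_zero, add_zero] at hMB
    rw [represented_subsingleton b _ hL hMB]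
    rw [← matB_eq_axialMat] at hB
    exact mul_mem (hle (hS M hM)) (Subgroup.subset_closure (Or.inr hB))

end AxialGroups

section SymmetrySet

variable {h : BilinForm ℝ V} {K : V →ₗ[ℝ] V →ₗ[ℝ] V} {b : Module.Basis (Fin 3) ℝ V}
  {a₁ a₂ a₄ a₅ a₆ : ℝ}

theorem IsONB.represented_matB_subset (hs : h.IsSymm) (hK : IsTracelessCubic h K) (hb : IsONB h b)
    (ha : HasONBCoeffs K b 0 a₂ 0 0 a₅ a₆ 0) :
    represented b matB ⊆ cubicStabilizer h K := fun L hL => by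
  rw [matB_eq_axialMat] at hL
  refine (hb.mem_cubicStabilizer_iff_of_axial hs hK ha (by norm_num) (by norm_num) hL).2 ?_
  norm_num

theorem IsONB.represented_matA_pi_subset (hs : h.IsSymm) (hK : IsTracelessCubic h K)
    (hb : IsONB h b) (ha : HasONBCoeffs K b a₁ 0 0 a₄ a₅ 0 0) :
    represented b (matA Real.pi) ⊆ cubicStabilizer h K := fun L hL => by
  rw [matA_pi_eq_axialMat] at hL
  refine (hb.mem_cubicStabilizer_iff_of_axial hs hK ha (by norm_num) (by norm_num) hL).2 ?_
  norm_num

theorem IsONB.represented_matA_two_pi_div_three_subset (hs : h.IsSymm)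
    (hK : IsTracelessCubic h K) (hb : IsONB h b)
    (ha : HasONBCoeffs K b (2 * a₄) 0 0 a₄ 0 a₆ 0) :
    represented b (matA (2 * Real.pi / 3)) ⊆ cubicStabilizer h K := fun L hL => by
  rw [matA_two_pi_div_three_eq_axialMat] at hL
  have hsqrt : √3 ^ 2 = 3 := Real.sq_sqrt three_pos.le
  refine (hb.mem_cubicStabilizer_iff_of_axial hs hK ha (one_pow 2) (by grind) hL).2 ?_
  refine ⟨?_, ?_, ?_, ?_, ?_, ?_, ?_⟩ <;> grind

theorem IsONB.represented_matA_subset (hs : h.IsSymm) (hK : IsTracelessCubic h K) (hb : IsONB h b)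
    (ha : HasONBCoeffs K b (2 * a₄) 0 0 a₄ 0 0 0) (θ : ℝ) :
    represented b (matA θ) ⊆ cubicStabilizer h K := fun L hL => by
  rw [matA_eq_axialMat] at hL
  have hcs := Real.cos_sq_add_sin_sq θ
  refine (hb.mem_cubicStabilizer_iff_of_axial hs hK ha (one_pow 2) hcs hL).2 ?_
  refine ⟨?_, ?_, ?_, ?_, ?_, ?_, ?_⟩ <;> grind

theorem IsLVB.represented_matC_subset (hs : h.IsSymm) (hK : IsTracelessCubic h K) (hb : IsLVB h b)
    {b₄ l : ℝ} (hc : HasLVBCoeffs K b 0 0 0 b₄ 0 0 0) (hl : l ≠ 0) :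
    represented b (matC l) ⊆ cubicStabilizer h K := fun L hL => by
  refine (hb.mem_cubicStabilizer_iff hs hK hc (hb.mem_specialIsometryGroup_of_matC hs hl hL)).2 ?_
  simpa using hb.matC_coeffs hs hK hc hl hL

theorem IsLVB.represented_matN_subset (hs : h.IsSymm) (hK : IsTracelessCubic h K) (hb : IsLVB h b)
    {b₇ : ℝ} (hc : HasLVBCoeffs K b 0 0 0 0 0 0 b₇) (m : ℝ) :
    represented b (matN m) ⊆ cubicStabilizer h K := fun L hL => by
  refine (hb.mem_cubicStabilizer_iff hs hK hc (hb.mem_specialIsometryGroup_of_matN hs hL)).2 ?_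
  simpa using hb.matN_coeffs hs hK hc hL

theorem cubicStabilizer_zero : cubicStabilizer h (0 : V →ₗ[ℝ] V →ₗ[ℝ] V) = specialIsometryGroup h :=
  le_antisymm (fun _ hL => hL.1) fun _ hL => ⟨hL, fun _ _ _ => by simp⟩

theorem symmetrySet_subset_cubicStabilizer (hs : h.IsSymm) (hK : IsTracelessCubic h K)
    {c : FormType} (hb : IsAdapted h b c) (hform : HasNormalForm K b c) :
    symmetrySet h b c ⊆ cubicStabilizer h K := by
  cases c with
  | zero =>
    obtain rfl : K = 0 := hform
    exact cubicStabilizer_zero.ge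
  | so2 =>
    obtain ⟨a₄, -, ha⟩ := hform
    rintro L ⟨θ, hL⟩
    exact hb.represented_matA_subset hs hK ha θ hL
  | s3 =>
    obtain ⟨a₆, -, ha⟩ := hform
    refine (Subgroup.closure_le _).2 (Set.union_subset ?_ (hb.represented_matB_subset hs hK ha))
    exact hb.represented_matA_two_pi_div_three_subset hs hK (a₄ := 0) (by rwa [mul_zero])
  | z3 =>
    obtain ⟨a₄, a₆, -, -, ha⟩ := hform
    exact (Subgroup.closure_le _).2 (hb.represented_matA_two_pi_div_three_subset hs hK ha)
  | z2B =>
    obtain ⟨a₂, a₅, a₆, -, -, ha⟩ := hform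
    exact (Subgroup.closure_le _).2 (hb.represented_matB_subset hs hK ha)
  | z2z2 =>
    obtain ⟨a₅, -, ha⟩ := hform
    exact (Subgroup.closure_le _).2 (Set.union_subset (hb.represented_matA_pi_subset hs hK ha)
      (hb.represented_matB_subset hs hK ha))
  | z2A =>
    obtain ⟨a₁, a₄, -, -, ha⟩ := hform
    exact (Subgroup.closure_le _).2 (hb.represented_matA_pi_subset hs hK ha)
  | so11 =>
    obtain ⟨b₄, -, hc⟩ := hform
    rintro L ⟨l, hl, hL⟩
    exact hb.represented_matC_subset hs hK hc hl hL
  | real =>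
    obtain ⟨b₇, -, hc⟩ := hform
    rintro L ⟨m, hL⟩
    exact hb.represented_matN_subset hs hK hc m hL

end SymmetrySet

section Stabilizers

variable {h : BilinForm ℝ V} {K : V →ₗ[ℝ] V →ₗ[ℝ] V} {b : Module.Basis (Fin 3) ℝ V}
  {L : V ≃ₗ[ℝ] V} {a₁ a₄ a₅ a₆ : ℝ}

-- `L` is an automorphism of the algebra `(V, K)`, and `K (b 0) (b 0) = -a₁ • b 0`: the
-- coordinates of `u = L (b 0)` therefore solve `h u u = -1` and `K u u = -a₁ • u`.
theorem IsONB.exists_axial_of_mem_cubicStabilizer (hs : h.IsSymm) (hb : IsONB h b)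
    (ha : HasONBCoeffs K b a₁ 0 0 a₄ a₅ a₆ 0)
    (haxis : ∀ α β γ : ℝ, β ^ 2 + γ ^ 2 = α ^ 2 - 1 →
      a₁ * α ^ 2 + a₄ * β ^ 2 + 2 * a₅ * β * γ + (a₁ - a₄) * γ ^ 2 = a₁ * α →
      2 * a₄ * α * β + 2 * a₅ * α * γ + a₆ * (β ^ 2 - γ ^ 2) = -a₁ * β →
      2 * a₅ * α * β + 2 * (a₁ - a₄) * α * γ - 2 * a₆ * β * γ = -a₁ * γ → β = 0 ∧ γ = 0)
    (hL : L ∈ cubicStabilizer h K) :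
    ∃ ε c s, ε ^ 2 = 1 ∧ c ^ 2 + s ^ 2 = 1 ∧ L ∈ represented b (axialMat ε c s) := by
  obtain ⟨α, β, γ, hu⟩ := exists_coords b (L (b 0))
  have hnorm : h (L (b 0)) (L (b 0)) = -1 := (hL.1.1 _ _).trans hb.1
  have hbb : K (b 0) (b 0) = -a₁ • b 0 := by
    simpa using ha.apply_eq 1 0 0 1 0 0
  have hsq : K (L (b 0)) (L (b 0)) = -a₁ • L (b 0) := by
    rw [map_apply_of_mem_cubicStabilizer (hb.separatingLeft hs) hL, hbb, map_smul]
  rw [hu, hb.apply_eq hs] at hnorm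
  rw [hu, ha.apply_eq, smul_add, smul_add, smul_smul, smul_smul, smul_smul, coords_inj] at hsq
  obtain ⟨e0, e1, e2⟩ := hsq
  obtain ⟨rfl, rfl⟩ := haxis α β γ (by linarith) (by linarith) (by linarith) (by linarith)
  exact ⟨α, hb.exists_axial_of_apply_timelike_eq_smul hs hL.1 (by simpa using hu)⟩

theorem IsONB.exists_axial_of_triaxial_coeffs (hs : h.IsSymm) (hb : IsONB h b)
    (ha : HasONBCoeffs K b (2 * a₄) 0 0 a₄ 0 a₆ 0) (hne : a₄ ≠ 0 ∨ a₆ ≠ 0)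
    (hL : L ∈ cubicStabilizer h K) :
    ∃ ε c s, ε ^ 2 = 1 ∧ c ^ 2 + s ^ 2 = 1 ∧ L ∈ represented b (axialMat ε c s) := by
  refine hb.exists_axial_of_mem_cubicStabilizer hs ha (fun α β γ hnorm e0 e1 e2 => ?_) hL
  suffices hsum : β ^ 2 + γ ^ 2 = 0 by
    exact ⟨by nlinarith [sq_nonneg β, sq_nonneg γ], by nlinarith [sq_nonneg β, sq_nonneg γ]⟩
  by_cases h4 : a₄ = 0
  · have h6 := hne.resolve_left (not_not.2 h4)
    subst h4
    have hdiff : β ^ 2 - γ ^ 2 = 0 := mul_left_cancel₀ h6 (by linear_combination e1)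
    have hprod : β * γ = 0 := mul_left_cancel₀ h6 (by linear_combination -e2 / 2)
    rcases mul_eq_zero.1 hprod with h0 | h0 <;> rw [h0] at hdiff ⊢ <;> linarith
  · have hα : (3 * α + 1) * (α - 1) = 0 :=
      mul_left_cancel₀ h4 (by linear_combination e0 - a₄ * hnorm)
    nlinarith [sq_nonneg β, sq_nonneg γ]

theorem eq_zero_of_square_eq_neg_smul {a d α β : ℝ} (ha : a ≠ 0) (hnorm : β ^ 2 = α ^ 2 - 1)
    (h0 : a * α ^ 2 + d * β ^ 2 = a * α) (h1 : 2 * d * α * β = -a * β) : β = 0 := by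
  by_contra hβ
  have hdα : a = -(2 * d * α) := mul_right_cancel₀ hβ (by linear_combination h1)
  have hd : d ≠ 0 := fun hd => ha (by rw [hdα, hd]; ring)
  have hroot : (α - 1) ^ 2 * (2 * α + 1) = 0 :=
    mul_left_cancel₀ hd (by linear_combination -h0 + d * hnorm + (α ^ 2 - α) * hdα)
  have hβ' : 0 < β ^ 2 := by positivity
  rcases mul_eq_zero.1 hroot with hα | hα
  · obtain rfl : α = 1 := by linarith [pow_eq_zero_iff two_ne_zero |>.1 hα]
    linarith
  · nlinarith

theorem IsONB.exists_axial_of_biaxial_coeffs (hs : h.IsSymm) (hb : IsONB h b)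
    (ha : HasONBCoeffs K b a₁ 0 0 a₄ 0 0 0) (ha₁ : a₁ ≠ 0) (hL : L ∈ cubicStabilizer h K) :
    ∃ ε c s, ε ^ 2 = 1 ∧ c ^ 2 + s ^ 2 = 1 ∧ L ∈ represented b (axialMat ε c s) := by
  refine hb.exists_axial_of_mem_cubicStabilizer hs ha (fun α β γ hnorm e0 e1 e2 => ?_) hL
  by_cases hβ : β = 0
  · subst hβ
    exact ⟨rfl, eq_zero_of_square_eq_neg_smul (α := α) (d := a₁ - a₄) ha₁ (by linarith)
      (by linarith) (by linarith)⟩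
  by_cases hγ : γ = 0
  · subst hγ
    exact ⟨eq_zero_of_square_eq_neg_smul (α := α) (d := a₄) ha₁ (by linarith) (by linarith)
      (by linarith), rfl⟩
  have hα₁ : 2 * a₄ * α = -a₁ := mul_right_cancel₀ hβ (by linarith)
  have hα₂ : 2 * (a₁ - a₄) * α = -a₁ := mul_right_cancel₀ hγ (by linarith)
  have hα : α = -1 := mul_left_cancel₀ ha₁ (by linear_combination (hα₁ + hα₂) / 2)
  rw [hα] at hnorm
  nlinarith [sq_nonneg γ, sq_pos_of_ne_zero hβ]

theorem IsONB.exists_axial_of_trihedral_coeffs (hs : h.IsSymm) (hb : IsONB h b)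
    (ha : HasONBCoeffs K b 0 0 0 0 a₅ 0 0) (h5 : a₅ ≠ 0) (hL : L ∈ cubicStabilizer h K) :
    ∃ ε c s, ε ^ 2 = 1 ∧ c ^ 2 + s ^ 2 = 1 ∧ L ∈ represented b (axialMat ε c s) := by
  refine hb.exists_axial_of_mem_cubicStabilizer hs ha (fun α β γ hnorm e0 e1 e2 => ?_) hL
  have hα : 2 * a₅ * α ≠ 0 :=
    mul_ne_zero (mul_ne_zero two_ne_zero h5) (by rintro rfl; nlinarith [sq_nonneg β, sq_nonneg γ])
  exact ⟨mul_left_cancel₀ hα (by linear_combination e2),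
    mul_left_cancel₀ hα (by linear_combination e1)⟩

theorem IsONB.cubicStabilizer_so2 (hs : h.IsSymm) (hK : IsTracelessCubic h K) (hb : IsONB h b)
    (ha : HasONBCoeffs K b (2 * a₄) 0 0 a₄ 0 0 0) (h4 : a₄ ≠ 0) :
    (cubicStabilizer h K : Set (V ≃ₗ[ℝ] V)) ⊆ symmetrySet h b .so2 := fun L hL => by
  obtain ⟨ε, c, s, hε, hcs, hmem⟩ := hb.exists_axial_of_triaxial_coeffs hs ha (Or.inl h4) hL
  obtain ⟨e1, -⟩ := (hb.mem_cubicStabilizer_iff_of_axial hs hK ha hε hcs hmem).1 hL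
  obtain rfl : ε = 1 := mul_right_cancel₀ (mul_ne_zero two_ne_zero h4) (by linarith)
  obtain ⟨θ, rfl, rfl⟩ := exists_cos_eq_and_sin_eq hcs
  exact ⟨θ, matA_eq_axialMat θ ▸ hmem⟩

theorem IsONB.cubicStabilizer_s3 (hs : h.IsSymm) (hK : IsTracelessCubic h K) (hb : IsONB h b)
    (ha : HasONBCoeffs K b 0 0 0 0 0 a₆ 0) (h6 : a₆ ≠ 0) :
    (cubicStabilizer h K : Set (V ≃ₗ[ℝ] V)) ⊆ symmetrySet h b .s3 := fun L hL => by
  obtain ⟨ε, c, s, hε, hcs, hmem⟩ := hb.exists_axial_of_triaxial_coeffs hs (a₄ := 0)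
    (by rwa [mul_zero]) (Or.inr h6) hL
  obtain ⟨-, -, -, -, -, e6, -⟩ := (hb.mem_cubicStabilizer_iff_of_axial hs hK ha hε hcs hmem).1 hL
  have hcube : c ^ 3 - 3 * c * s ^ 2 = 1 := mul_left_cancel₀ h6 (by linear_combination e6)
  exact mem_closure_union_matB hε hcs
    (fun M hM => mem_closure_matA_of_cube_eq_one hcs hcube hM) hmem

theorem IsONB.cubicStabilizer_z3 (hs : h.IsSymm) (hK : IsTracelessCubic h K) (hb : IsONB h b)
    (ha : HasONBCoeffs K b (2 * a₄) 0 0 a₄ 0 a₆ 0) (h4 : a₄ ≠ 0) (h6 : a₆ ≠ 0) :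
    (cubicStabilizer h K : Set (V ≃ₗ[ℝ] V)) ⊆ symmetrySet h b .z3 := fun L hL => by
  obtain ⟨ε, c, s, hε, hcs, hmem⟩ := hb.exists_axial_of_triaxial_coeffs hs ha (Or.inl h4) hL
  obtain ⟨e1, -, -, -, -, e6, -⟩ := (hb.mem_cubicStabilizer_iff_of_axial hs hK ha hε hcs hmem).1 hL
  obtain rfl : ε = 1 := mul_right_cancel₀ (mul_ne_zero two_ne_zero h4) (by linarith)
  exact mem_closure_matA_of_cube_eq_one hcs (mul_left_cancel₀ h6 (by linear_combination e6)) hmem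

theorem IsONB.cubicStabilizer_z2z2 (hs : h.IsSymm) (hK : IsTracelessCubic h K) (hb : IsONB h b)
    (ha : HasONBCoeffs K b 0 0 0 0 a₅ 0 0) (h5 : a₅ ≠ 0) :
    (cubicStabilizer h K : Set (V ≃ₗ[ℝ] V)) ⊆ symmetrySet h b .z2z2 := fun L hL => by
  obtain ⟨ε, c, s, hε, hcs, hmem⟩ := hb.exists_axial_of_trihedral_coeffs hs ha h5 hL
  obtain ⟨-, -, -, -, e5, -⟩ := (hb.mem_cubicStabilizer_iff_of_axial hs hK ha hε hcs hmem).1 hL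
  have hsub : c ^ 2 - s ^ 2 = 1 := mul_right_cancel₀ h5 (by linear_combination e5)
  obtain rfl : s = 0 := by nlinarith
  have hc : c ^ 2 = 1 := by linarith
  exact mem_closure_union_matB hε hcs (fun M hM => mem_closure_matA_pi hc hM) hmem

theorem IsONB.cubicStabilizer_z2A (hs : h.IsSymm) (hK : IsTracelessCubic h K) (hb : IsONB h b)
    (ha : HasONBCoeffs K b a₁ 0 0 a₄ 0 0 0) (h1 : a₁ ≠ 0) (h14 : a₁ ≠ 2 * a₄) :
    (cubicStabilizer h K : Set (V ≃ₗ[ℝ] V)) ⊆ symmetrySet h b .z2A := fun L hL => by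
  obtain ⟨ε, c, s, hε, hcs, hmem⟩ := hb.exists_axial_of_biaxial_coeffs hs ha h1 hL
  obtain ⟨e1, -, -, e4, -⟩ := (hb.mem_cubicStabilizer_iff_of_axial hs hK ha hε hcs hmem).1 hL
  obtain rfl : ε = 1 := mul_right_cancel₀ h1 (by linarith)
  have hsq : s ^ 2 = 0 :=
    mul_right_cancel₀ (sub_ne_zero.2 h14) (by linear_combination e4 - a₄ * hcs)
  obtain rfl : s = 0 := pow_eq_zero_iff two_ne_zero |>.1 hsq
  exact mem_closure_matA_pi (by linarith) hmem

theorem IsLVB.cubicStabilizer_so11 (hs : h.IsSymm) (hb : IsLVB h b) {b₄ : ℝ}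
    (hc : HasLVBCoeffs K b 0 0 0 b₄ 0 0 0) (h4 : b₄ ≠ 0) :
    (cubicStabilizer h K : Set (V ≃ₗ[ℝ] V)) ⊆ symmetrySet h b .so11 := fun L hL => by
  obtain ⟨α, β, γ, hu⟩ := exists_coords b (L (b 1))
  have hnorm : h (L (b 1)) (L (b 1)) = 1 := (hL.1.1 _ _).trans hb.2.2.2.2.2
  have hbb : K (b 1) (b 1) = (-2 * b₄) • b 1 := by
    simpa using hc.apply_eq 0 1 0 0 1 0
  have hsq : K (L (b 1)) (L (b 1)) = (-2 * b₄) • L (b 1) := by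
    rw [map_apply_of_mem_cubicStabilizer (hb.separatingLeft hs) hL, hbb, map_smul]
  rw [hu, hb.apply_eq hs] at hnorm
  rw [hu, hc.apply_eq, smul_add, smul_add, smul_smul, smul_smul, smul_smul, coords_inj] at hsq
  obtain ⟨e0, e1, e2⟩ := hsq
  replace e0 : α * (β + 1) = 0 := mul_left_cancel₀ h4 (by linear_combination e0 / 2)
  replace e1 : α * γ - β ^ 2 + β = 0 := mul_left_cancel₀ h4 (by linear_combination e1 / 2)
  replace e2 : γ * (β + 1) = 0 := mul_left_cancel₀ h4 (by linear_combination e2 / 2)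
  have hβ : β + 1 ≠ 0 := fun hβ => by
    obtain rfl : β = -1 := by linarith
    linarith
  obtain rfl : α = 0 := (mul_eq_zero.1 e0).resolve_right hβ
  obtain rfl : γ = 0 := (mul_eq_zero.1 e2).resolve_right hβ
  obtain rfl : β = 1 := by linarith
  exact hb.exists_matC_of_apply_spacelike_eq hs hL.1 (by simpa using hu)

theorem IsLVB.cubicStabilizer_real (hs : h.IsSymm) (hb : IsLVB h b)
    {b₇ : ℝ} (hc : HasLVBCoeffs K b 0 0 0 0 0 0 b₇) (h7 : b₇ ≠ 0) :
    (cubicStabilizer h K : Set (V ≃ₗ[ℝ] V)) ⊆ symmetrySet h b .real := fun L hL => by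
  obtain ⟨p, q, r, hf⟩ := exists_coords b (L (b 2))
  have hff : K (b 2) (b 2) = b₇ • b 0 := by
    simpa using hc.apply_eq 0 0 1 0 0 1
  have hsq : K (L (b 2)) (L (b 2)) = b₇ • L (b 0) := by
    rw [map_apply_of_mem_cubicStabilizer (hb.separatingLeft hs) hL, hff, map_smul]
  have he : L (b 0) = r ^ 2 • b 0 := by
    rw [hf, hc.apply_eq] at hsq
    refine smul_right_injective V h7 (hsq.symm.trans ?_)
    module
  have hr : r ^ 3 = 1 := by
    have h02 := (hL.1.1 (b 0) (b 2)).trans hb.2.2.1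
    rw [he, hf, ← (show r ^ 2 • b 0 + (0 : ℝ) • b 1 + (0 : ℝ) • b 2 = r ^ 2 • b 0 by module),
      hb.apply_eq hs] at h02
    linarith
  obtain rfl : r = 1 := (Odd.pow_inj (by decide : Odd 3)).1 (hr.trans (one_pow 3).symm)
  exact hb.exists_matN_of_apply_lightlike_eq hs hL.1 (by rw [he, one_pow, one_smul])

theorem cubicStabilizer_eq_symmetrySet (hs : h.IsSymm) (hK : IsTracelessCubic h K)
    {c : FormType} (hb : IsAdapted h b c) (hform : HasNormalForm K b c)
    (hB : c ≠ .z2B) (hA : c ≠ .z2A) :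
    (cubicStabilizer h K : Set (V ≃ₗ[ℝ] V)) = symmetrySet h b c := by
  refine (symmetrySet_subset_cubicStabilizer hs hK hb hform).antisymm' ?_
  cases c with
  | zero => exact fun L hL => hL.1
  | so2 =>
    obtain ⟨a₄, h4, ha⟩ := hform
    exact hb.cubicStabilizer_so2 hs hK ha h4.ne'
  | s3 =>
    obtain ⟨a₆, h6, ha⟩ := hform
    exact hb.cubicStabilizer_s3 hs hK ha h6.ne'
  | z3 =>
    obtain ⟨a₄, a₆, h4, h6, ha⟩ := hform
    exact hb.cubicStabilizer_z3 hs hK ha h4.ne' h6.ne'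
  | z2B => exact absurd rfl hB
  | z2z2 =>
    obtain ⟨a₅, h5, ha⟩ := hform
    exact hb.cubicStabilizer_z2z2 hs hK ha h5.ne'
  | z2A => exact absurd rfl hA
  | so11 =>
    obtain ⟨b₄, h4, hc⟩ := hform
    exact hb.cubicStabilizer_so11 hs hc h4.ne'
  | real =>
    obtain ⟨b₇, h7, hc⟩ := hform
    exact hb.cubicStabilizer_real hs hc h7.ne'

end Stabilizers

section AdaptedBases

variable {h : BilinForm ℝ V} {b : Module.Basis (Fin 3) ℝ V} {L : V ≃ₗ[ℝ] V} {x y : V}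

theorem exists_isometry_of_ne_zero (hs : h.IsSymm) {d : V} (hd : h d d ≠ 0) :
    ∃ L : V ≃ₗ[ℝ] V, (∀ x y, h (L x) (L y) = h x y) ∧
      ∀ x, h d d * 2⁻¹ = h d x → L x = x - d := by
  have href : LinearMap.IsReflective h d := ⟨.of_ne_zero hd, fun y => (isUnit_iff_ne_zero.2 hd).dvd⟩
  refine ⟨Module.reflection (href.coroot_apply_self h), href.isOrthogonal_reflection h ⟨hs.eq⟩, ?_⟩
  intro x hx
  have hcoroot : href.coroot h x = 1 :=
    mul_left_cancel₀ hd (by rw [href.apply_self_mul_coroot_apply, ← hx]; ring)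
  rw [Module.reflection_apply, hcoroot, one_smul]

theorem exists_isometry_apply_eq (hs : h.IsSymm) (hxy : h x x = h y y) (hx : h x x ≠ 0) :
    ∃ L : V ≃ₗ[ℝ] V, (∀ x y, h (L x) (L y) = h x y) ∧ L x = y := by
  have hcomm := hs.eq x y
  have hadd : h (x + y) (x + y) = 2 * (h x x + h x y) := by
    simp only [map_add, LinearMap.add_apply, ← hcomm, ← hxy]
    ring
  have hsub : h (x - y) (x - y) = 2 * (h x x - h x y) := by
    simp only [map_sub, LinearMap.sub_apply, ← hcomm, ← hxy]
    ring
  by_cases hd : h (x - y) (x - y) = 0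
  · obtain ⟨L, hiso, hL⟩ := exists_isometry_of_ne_zero hs (d := x + y) fun h0 => hx (by linarith)
    refine ⟨L.trans (LinearEquiv.neg ℝ), fun u v => by simp [hiso], ?_⟩
    have hLx := hL x (by rw [hadd, map_add, LinearMap.add_apply, ← hcomm]; ring)
    simp [hLx]
  · obtain ⟨L, hiso, hL⟩ := exists_isometry_of_ne_zero hs hd
    refine ⟨L, hiso, ?_⟩
    rw [hL x (by rw [hsub, map_sub, LinearMap.sub_apply, ← hcomm]; ring), sub_sub_cancel]

theorem IsONB.exists_apply_zero_eq (hs : h.IsSymm) (hb : IsONB h b) (hx : h x x = -1) :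
    ∃ b' : Module.Basis (Fin 3) ℝ V, IsONB h b' ∧ b' 0 = x := by
  obtain ⟨L, hiso, hL⟩ := exists_isometry_apply_eq hs (hb.1.trans hx.symm) (by simp [hb.1])
  exact ⟨b.map L, hb.map hiso, hL⟩

theorem IsONB.exists_apply_one_eq (hs : h.IsSymm) (hb : IsONB h b) (hx : h x x = 1) :
    ∃ b' : Module.Basis (Fin 3) ℝ V, IsONB h b' ∧ b' 1 = x := by
  obtain ⟨L, hiso, hL⟩ := exists_isometry_apply_eq hs (hb.2.1.trans hx.symm) (by simp [hb.2.1])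
  exact ⟨b.map L, hb.map hiso, hL⟩

theorem IsONB.exists_isLVB_apply_one_eq (hs : h.IsSymm) (hb : IsONB h b) (hx : h x x = 1) :
    ∃ b' : Module.Basis (Fin 3) ℝ V, IsLVB h b' ∧ b' 1 = x := by
  obtain ⟨b, hb, rfl⟩ := hb.exists_apply_one_eq hs hx
  obtain ⟨L, hL⟩ := exists_mem_represented b (A := !![1, 0, -1 / 2; 0, 1, 0; 1, 0, 1 / 2])
    (by simp only [Matrix.det_fin_three, Matrix.of_apply, Matrix.cons_val]; norm_num)
  obtain ⟨h0, h1, h2⟩ := mem_represented_iff_columns.1 hL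
  simp only [Matrix.of_apply, Matrix.cons_val] at h0 h1 h2
  refine ⟨b.map L, ?_, by simp [h1]⟩
  simp only [IsLVB, Module.Basis.map_apply, h0, h1, h2, hb.apply_eq hs]
  norm_num

theorem IsONB.exists_isLVB_apply_zero_eq (hs : h.IsSymm) (hb : IsONB h b) (hx : h x x = 0)
    (hx0 : x ≠ 0) : ∃ b' : Module.Basis (Fin 3) ℝ V, IsLVB h b' ∧ b' 0 = x := by
  obtain ⟨p, q, r, rfl⟩ := exists_coords b x
  rw [hb.apply_eq hs] at hx
  have hp : p ≠ 0 := by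
    rintro rfl
    have hq : q = 0 := by nlinarith [mul_self_nonneg r, mul_self_nonneg q]
    have hr : r = 0 := by nlinarith [mul_self_nonneg r, mul_self_nonneg q]
    exact hx0 (by simp [hq, hr])
  obtain ⟨L, hL⟩ := exists_mem_represented b
    (A := !![p, 0, -1 / (2 * p); q, -r / p, q / (2 * p ^ 2); r, q / p, r / (2 * p ^ 2)]) (by
      refine isUnit_iff_ne_zero.2 (ne_of_eq_of_ne ?_ (neg_ne_zero.2 one_ne_zero))
      simp only [Matrix.det_fin_three, Matrix.of_apply, Matrix.cons_val]
      field_simp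
      linarith)
  obtain ⟨h0, h1, h2⟩ := mem_represented_iff_columns.1 hL
  simp only [Matrix.of_apply, Matrix.cons_val] at h0 h1 h2
  refine ⟨b.map L, ?_, h0⟩
  simp only [IsLVB, Module.Basis.map_apply, h0, h1, h2, hb.apply_eq hs]
  refine ⟨?_, ?_, ?_, ?_, ?_, ?_⟩ <;> field_simp <;> linarith

theorem exists_fixed_vector (hnd : h.SeparatingLeft) (hodd : Odd (Module.finrank ℝ V))
    (hL : L ∈ specialIsometryGroup h) : ∃ x, x ≠ 0 ∧ L x = x := by
  have := Module.finite_of_finrank_pos hodd.pos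
  let b := Module.finBasis ℝ V
  let D : V →ₗ[ℝ] V := (L : V →ₗ[ℝ] V) - LinearMap.id
  have hG := (LinearMap.separatingLeft_iff_det_ne_zero b).1 hnd
  have hadj : LinearMap.compl₁₂ h D (L : V →ₗ[ℝ] V) = LinearMap.compl₂ h (-D) := by
    ext x y
    simp [D, hL.1 x y]
  have hdet : LinearMap.det D * (LinearMap.toMatrix₂ b b h).det =
      -(LinearMap.toMatrix₂ b b h).det * LinearMap.det D := by
    have := congrArg (fun B => (LinearMap.toMatrix₂ b b B).det) hadj
    simpa [LinearMap.toMatrix₂_compl₁₂ b b, LinearMap.toMatrix₂_compl₂ b b, hL.2, hodd.neg_one_pow,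
      Matrix.det_neg] using this
  have hD : LinearMap.det D = 0 := mul_right_cancel₀ hG (by linarith)
  obtain ⟨x, hx, hx0⟩ := (Submodule.ne_bot_iff _).1 (LinearMap.bot_lt_ker_of_det_eq_zero hD).ne'
  exact ⟨x, hx0, sub_eq_zero.1 hx⟩

theorem exists_fixed_unit_or_lightlike (hnd : h.SeparatingLeft) (hodd : Odd (Module.finrank ℝ V))
    (hL : L ∈ specialIsometryGroup h) :
    ∃ x, L x = x ∧ (h x x = -1 ∨ h x x = 1 ∨ h x x = 0 ∧ x ≠ 0) := by
  obtain ⟨x, hx0, hLx⟩ := exists_fixed_vector hnd hodd hL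
  by_cases hx : h x x = 0
  · exact ⟨x, hLx, Or.inr (Or.inr ⟨hx, hx0⟩)⟩
  refine ⟨(√|h x x|)⁻¹ • x, by rw [map_smul, hLx], ?_⟩
  have hsq : h ((√|h x x|)⁻¹ • x) ((√|h x x|)⁻¹ • x) = h x x / |h x x| := by
    rw [LinearMap.map_smul₂, map_smul, smul_eq_mul, smul_eq_mul, ← mul_assoc, ← mul_inv,
      Real.mul_self_sqrt (abs_nonneg _), inv_mul_eq_div]
  rw [hsq]
  rcases lt_or_gt_of_ne hx with hneg | hpos
  · exact Or.inl (by rw [abs_of_neg hneg, div_neg, div_self hx])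
  · exact Or.inr (Or.inl (by rw [abs_of_pos hpos, div_self hx]))

end AdaptedBases

section NormalForms

variable {h : BilinForm ℝ V} {K : V →ₗ[ℝ] V →ₗ[ℝ] V} {b : Module.Basis (Fin 3) ℝ V}
  {a₁ a₂ a₃ a₄ a₅ a₆ a₇ ε c s : ℝ}

/-- `K` has one of the nine normal forms in an adapted basis for which the group attached to that
form is the whole stabilizer of `K`. -/
def AttainsNormalForm (h : BilinForm ℝ V) (K : V →ₗ[ℝ] V →ₗ[ℝ] V) : Prop :=
  ∃ (c : FormType) (b : Module.Basis (Fin 3) ℝ V), IsAdapted h b c ∧ HasNormalForm K b c ∧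
    (cubicStabilizer h K : Set (V ≃ₗ[ℝ] V)) = symmetrySet h b c

theorem attainsNormalForm_of_hasNormalForm (hs : h.IsSymm) (hK : IsTracelessCubic h K)
    (c : FormType) (hb : IsAdapted h b c) (hform : HasNormalForm K b c) (hB : c ≠ .z2B)
    (hA : c ≠ .z2A) : AttainsNormalForm h K :=
  ⟨c, b, hb, hform, cubicStabilizer_eq_symmetrySet hs hK hb hform hB hA⟩

theorem HasONBCoeffs.eq_zero (ha : HasONBCoeffs K b 0 0 0 0 0 0 0) : K = 0 := by
  ext x y
  obtain ⟨p, q, r, rfl⟩ := exists_coords b x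
  obtain ⟨p', q', r', rfl⟩ := exists_coords b y
  rw [ha.apply_eq]
  simp

theorem HasLVBCoeffs.eq_zero (hc : HasLVBCoeffs K b 0 0 0 0 0 0 0) : K = 0 := by
  ext x y
  obtain ⟨p, q, r, rfl⟩ := exists_coords b x
  obtain ⟨p', q', r', rfl⟩ := exists_coords b y
  rw [hc.apply_eq]
  simp

theorem IsONB.exists_axial_coeffs (hs : h.IsSymm) (hK : IsTracelessCubic h K) (hb : IsONB h b)
    (ha : HasONBCoeffs K b a₁ a₂ a₃ a₄ a₅ a₆ a₇) (hε : ε ^ 2 = 1) (hcs : c ^ 2 + s ^ 2 = 1) :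
    ∃ b' : Module.Basis (Fin 3) ℝ V, IsONB h b' ∧
      HasONBCoeffs K b' (ε * a₁) (c * a₂ + s * a₃) (ε * (c * a₃ - s * a₂))
        (ε * (c ^ 2 * a₄ + 2 * c * s * a₅ + s ^ 2 * (a₁ - a₄)))
        ((c ^ 2 - s ^ 2) * a₅ + c * s * (a₁ - 2 * a₄))
        (c ^ 3 * a₆ + 3 * c ^ 2 * s * a₇ + 3 * c * s ^ 2 * (a₂ - a₆) + s ^ 3 * (a₃ - a₇))
        (ε * (-(c ^ 2 * s * a₆) + (c ^ 3 - 2 * c * s ^ 2) * a₇ +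
          (2 * c ^ 2 * s - s ^ 3) * (a₂ - a₆) + s ^ 2 * c * (a₃ - a₇))) := by
  obtain ⟨L, hL⟩ := exists_mem_represented_axialMat b hε hcs
  exact ⟨b.map L, hb.map (hb.mem_specialIsometryGroup_of_axial hs hε hcs hL).1,
    hb.axial_coeffs hs hK ha hε hcs hL⟩

theorem IsONB.exists_flipped_coeffs (hs : h.IsSymm) (hK : IsTracelessCubic h K) (hb : IsONB h b)
    (ha : HasONBCoeffs K b a₁ a₂ a₃ a₄ a₅ a₆ a₇) :
    ∃ b' : Module.Basis (Fin 3) ℝ V, IsONB h b' ∧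
      HasONBCoeffs K b' (-a₁) a₂ (-a₃) (-a₄) a₅ a₆ (-a₇) := by
  have hflip := hb.exists_axial_coeffs hs hK ha (ε := -1) (c := 1) (s := 0) (by norm_num)
    (by norm_num)
  convert hflip using 4 <;> ring

theorem IsONB.attainsNormalForm_of_triaxial_of_nonneg (hs : h.IsSymm) (hK : IsTracelessCubic h K)
    (hb : IsONB h b) (ha : HasONBCoeffs K b (2 * a₄) 0 0 a₄ 0 a₆ 0) (h4 : 0 ≤ a₄) (h6 : 0 ≤ a₆) :
    AttainsNormalForm h K := by
  rcases h4.eq_or_lt with rfl | h4 <;> rcases h6.eq_or_lt with rfl | h6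
  · rw [mul_zero] at ha
    exact attainsNormalForm_of_hasNormalForm hs hK .zero hb ha.eq_zero nofun nofun
  · rw [mul_zero] at ha
    exact attainsNormalForm_of_hasNormalForm hs hK .s3 hb ⟨a₆, h6, ha⟩ nofun nofun
  · exact attainsNormalForm_of_hasNormalForm hs hK .so2 hb ⟨a₄, h4, ha⟩ nofun nofun
  · exact attainsNormalForm_of_hasNormalForm hs hK .z3 hb ⟨a₄, a₆, h4, h6, ha⟩ nofun nofun

-- The weight-three part `a₆ + i a₇` is multiplied by `exp (-3 i θ)` under rotation by `θ`.
theorem IsONB.attainsNormalForm_of_triaxial (hs : h.IsSymm) (hK : IsTracelessCubic h K)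
    (hb : IsONB h b) (ha : HasONBCoeffs K b (2 * a₄) 0 0 a₄ 0 a₆ a₇) : AttainsNormalForm h K := by
  wlog h4 : 0 ≤ a₄ generalizing b a₄ a₇
  · obtain ⟨b', hb', ha'⟩ := hb.exists_flipped_coeffs hs hK ha
    rw [neg_zero, ← mul_neg] at ha'
    exact this hb' ha' (by linarith)
  obtain ⟨r, θ, hr, rfl, rfl⟩ := exists_polar 3 a₆ a₇
  obtain ⟨b', hb', ha'⟩ := hb.exists_axial_coeffs hs hK ha (one_pow 2) (Real.cos_sq_add_sin_sq θ)
  refine hb'.attainsNormalForm_of_triaxial_of_nonneg hs hK ?_ h4 hr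
  have hcs := Real.cos_sq_add_sin_sq θ
  convert ha' using 1 <;> push_cast [Real.cos_three_mul, Real.sin_three_mul] <;> grind

theorem IsONB.attainsNormalForm_of_diagonal (hs : h.IsSymm) (hK : IsTracelessCubic h K)
    (hb : IsONB h b) (ha : HasONBCoeffs K b a₁ 0 0 a₄ 0 0 0) (h1 : a₁ ≠ 0) :
    AttainsNormalForm h K := by
  wlog hpos : 0 < a₁ generalizing b a₁ a₄
  · obtain ⟨b', hb', ha'⟩ := hb.exists_flipped_coeffs hs hK ha
    rw [neg_zero] at ha'
    exact this hb' ha' (neg_ne_zero.2 h1) (neg_pos.2 (lt_of_le_of_ne (not_lt.1 hpos) h1))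
  by_cases h14 : a₁ = 2 * a₄
  · subst h14
    exact attainsNormalForm_of_hasNormalForm hs hK .so2 hb ⟨a₄, by linarith, ha⟩ nofun nofun
  · have hform : HasNormalForm K b .z2A := ⟨a₁, a₄, Or.inl hpos, h14, ha⟩
    exact ⟨.z2A, b, hb, hform, (hb.cubicStabilizer_z2A hs hK ha h1 h14).antisymm
      (symmetrySet_subset_cubicStabilizer hs hK hb hform)⟩

-- The weight-two part `(a₄ - a₁ / 2) + i a₅` is multiplied by `exp (-2 i θ)` under rotation by `θ`.
theorem IsONB.attainsNormalForm_of_biaxial (hs : h.IsSymm) (hK : IsTracelessCubic h K)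
    (hb : IsONB h b) (ha : HasONBCoeffs K b a₁ 0 0 a₄ a₅ 0 0) : AttainsNormalForm h K := by
  by_cases h1 : a₁ = 0
  · subst h1
    obtain ⟨r, θ, hr, rfl, h4⟩ := exists_polar 2 a₅ (-a₄)
    obtain rfl : a₄ = -(r * Real.sin ((2 : ℕ) * θ)) := by linarith
    have hcs := Real.cos_sq_add_sin_sq θ
    obtain ⟨b', hb', ha'⟩ := hb.exists_axial_coeffs hs hK ha (one_pow 2) hcs
    replace ha' : HasONBCoeffs K b' 0 0 0 0 r 0 0 := by
      convert ha' using 1 <;> push_cast [Real.cos_two_mul, Real.sin_two_mul] <;> grind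
    rcases hr.eq_or_lt with rfl | hr
    · exact attainsNormalForm_of_hasNormalForm hs hK .zero hb' ha'.eq_zero nofun nofun
    · exact attainsNormalForm_of_hasNormalForm hs hK .z2z2 hb' ⟨r, hr, ha'⟩ nofun nofun
  · obtain ⟨r, θ, -, h4, rfl⟩ := exists_polar 2 (a₄ - a₁ / 2) a₅
    obtain rfl : a₄ = a₁ / 2 + r * Real.cos ((2 : ℕ) * θ) := by linarith
    have hcs := Real.cos_sq_add_sin_sq θ
    obtain ⟨b', hb', ha'⟩ := hb.exists_axial_coeffs hs hK ha (one_pow 2) hcs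
    refine hb'.attainsNormalForm_of_diagonal hs hK (a₁ := a₁) (a₄ := a₁ / 2 + r) ?_ h1
    convert ha' using 1 <;> push_cast [Real.cos_two_mul, Real.sin_two_mul] <;> grind

end NormalForms

section Existence

variable {h : BilinForm ℝ V} {K : V →ₗ[ℝ] V →ₗ[ℝ] V} {b : Module.Basis (Fin 3) ℝ V}
  {L : V ≃ₗ[ℝ] V}

theorem eq_zero_of_rotation_fixed {c s x y : ℝ} (hcs : c ^ 2 + s ^ 2 = 1) (hc : c ≠ 1)
    (hx : c * x + s * y = x) (hy : c * y - s * x = y) : x = 0 ∧ y = 0 := by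
  have hc' : 2 * (1 - c) ≠ 0 := mul_ne_zero two_ne_zero (sub_ne_zero.2 hc.symm)
  exact ⟨mul_left_cancel₀ hc' (by linear_combination -(1 - c) * hx - s * hy - x * hcs),
    mul_left_cancel₀ hc' (by linear_combination -(1 - c) * hy + s * hx - y * hcs)⟩

theorem IsONB.attainsNormalForm_of_apply_timelike_eq (hs : h.IsSymm) (hK : IsTracelessCubic h K)
    (hb : IsONB h b) (hL : L ∈ cubicStabilizer h K) (hL1 : L ≠ 1) (h0 : L (b 0) = b 0) :
    AttainsNormalForm h K := by
  obtain ⟨a₁, a₂, a₃, a₄, a₅, a₆, a₇, ha⟩ :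
      ∃ a₁ a₂ a₃ a₄ a₅ a₆ a₇, HasONBCoeffs K b a₁ a₂ a₃ a₄ a₅ a₆ a₇ :=
    ⟨_, _, _, _, _, _, _, hK.hasONBCoeffs hs hb⟩
  obtain ⟨c, s, -, hcs, hmem⟩ :=
    hb.exists_axial_of_apply_timelike_eq_smul hs hL.1 (h0.trans (one_smul ℝ _).symm)
  obtain ⟨-, e2, e3, e4, e5, e6, e7⟩ :=
    (hb.mem_cubicStabilizer_iff_of_axial hs hK ha (one_pow 2) hcs hmem).1 hL
  have hc : c ≠ 1 := by
    rintro rfl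
    obtain rfl : s = 0 := by nlinarith
    exact hL1 (mem_represented_axialMat_one_iff.1 hmem)
  obtain ⟨rfl, rfl⟩ := eq_zero_of_rotation_fixed hcs hc e2 (by linarith)
  by_cases hs0 : s = 0
  · subst hs0
    obtain rfl : c = -1 := (sq_eq_one_iff.1 (by linarith)).resolve_left hc
    obtain rfl : a₆ = 0 := by linarith
    obtain rfl : a₇ = 0 := by linarith
    exact hb.attainsNormalForm_of_biaxial hs hK ha
  · obtain ⟨hd, rfl⟩ := eq_zero_of_rotation_fixed (c := c ^ 2 - s ^ 2) (s := 2 * c * s)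
      (x := a₄ - a₁ / 2) (y := a₅) (by linear_combination (c ^ 2 + s ^ 2 + 1) * hcs)
      (fun hc2 => hs0 (by nlinarith)) (by linear_combination e4 - a₁ / 2 * hcs) (by linarith)
    obtain rfl : a₁ = 2 * a₄ := by linarith
    exact hb.attainsNormalForm_of_triaxial hs hK ha

theorem IsLVB.attainsNormalForm_of_boost_coeffs (hs : h.IsSymm) (hK : IsTracelessCubic h K)
    (hK0 : K ≠ 0) (hb : IsLVB h b) {b₄ : ℝ} (hc : HasLVBCoeffs K b 0 0 0 b₄ 0 0 0) :
    AttainsNormalForm h K := by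
  rcases lt_trichotomy b₄ 0 with h4 | rfl | h4
  · have hc' := hb.neg_coeffs hs hK hc
    rw [neg_zero] at hc'
    exact attainsNormalForm_of_hasNormalForm hs hK .so11 (hb.map fun x y => by simp)
      ⟨-b₄, neg_pos.2 h4, hc'⟩ nofun nofun
  · exact absurd hc.eq_zero hK0
  · exact attainsNormalForm_of_hasNormalForm hs hK .so11 hb ⟨b₄, h4, hc⟩ nofun nofun

theorem IsLVB.attainsNormalForm_of_nullRotation_coeffs (hs : h.IsSymm)
    (hK : IsTracelessCubic h K) (hK0 : K ≠ 0) (hb : IsLVB h b) {b₇ : ℝ}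
    (hc : HasLVBCoeffs K b 0 0 0 0 0 0 b₇) : AttainsNormalForm h K := by
  rcases lt_trichotomy b₇ 0 with h7 | rfl | h7
  · have hc' := hb.neg_coeffs hs hK hc
    rw [neg_zero] at hc'
    exact attainsNormalForm_of_hasNormalForm hs hK .real (hb.map fun x y => by simp)
      ⟨-b₇, neg_pos.2 h7, hc'⟩ nofun nofun
  · exact absurd hc.eq_zero hK0
  · exact attainsNormalForm_of_hasNormalForm hs hK .real hb ⟨b₇, h7, hc⟩ nofun nofun

theorem IsLVB.attainsNormalForm_of_matC (hs : h.IsSymm) (hK : IsTracelessCubic h K)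
    (hK0 : K ≠ 0) (hb : IsLVB h b) {l : ℝ} (hl : l ≠ 0) (hl1 : l ^ 2 ≠ 1)
    (hL : L ∈ cubicStabilizer h K) (hmem : L ∈ represented b (matC l)) :
    AttainsNormalForm h K := by
  obtain ⟨b₁, b₂, b₃, b₄, b₅, b₆, b₇, hc⟩ :
      ∃ b₁ b₂ b₃ b₄ b₅ b₆ b₇, HasLVBCoeffs K b b₁ b₂ b₃ b₄ b₅ b₆ b₇ :=
    ⟨_, _, _, _, _, _, _, hK.hasLVBCoeffs hs hb⟩
  obtain ⟨e1, e2, e3, -, e5, e6, e7⟩ := (hb.matC_coeffs hs hK hc hl hmem).unique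
    ((hb.mem_cubicStabilizer_iff hs hK hc hL.1).1 hL)
  have hl₁ : l ≠ 1 := fun h1 => hl1 (by rw [h1, one_pow])
  have hl₃ : l ^ 3 ≠ 1 := fun h3 =>
    hl₁ ((Odd.pow_inj (by decide : Odd 3)).1 (h3.trans (one_pow 3).symm))
  rw [div_eq_iff (by positivity), eq_comm, mul_right_eq_self₀] at e5 e6 e7
  obtain rfl := (mul_left_eq_self₀.1 e1).resolve_left hl₁
  obtain rfl := (mul_left_eq_self₀.1 e2).resolve_left hl1
  obtain rfl := (mul_left_eq_self₀.1 e3).resolve_left hl₃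
  obtain rfl := e5.resolve_left hl₁
  obtain rfl := e6.resolve_left hl1
  obtain rfl := e7.resolve_left hl₃
  exact hb.attainsNormalForm_of_boost_coeffs hs hK hK0 hc

theorem IsLVB.attainsNormalForm_of_matN (hs : h.IsSymm) (hK : IsTracelessCubic h K)
    (hK0 : K ≠ 0) (hb : IsLVB h b) {m : ℝ} (hm : m ≠ 0) (hL : L ∈ cubicStabilizer h K)
    (hmem : L ∈ represented b (matN m)) : AttainsNormalForm h K := by
  obtain ⟨b₁, b₂, b₃, b₄, b₅, b₆, b₇, hc⟩ :
      ∃ b₁ b₂ b₃ b₄ b₅ b₆ b₇, HasLVBCoeffs K b b₁ b₂ b₃ b₄ b₅ b₆ b₇ :=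
    ⟨_, _, _, _, _, _, _, hK.hasLVBCoeffs hs hb⟩
  obtain ⟨e1, e2, -, e4, e5, e6, e7⟩ := (hb.matN_coeffs hs hK hc hmem).unique
    ((hb.mem_cubicStabilizer_iff hs hK hc hL.1).1 hL)
  obtain rfl : b₃ = 0 := mul_left_cancel₀ hm (by linarith)
  obtain rfl : b₂ = 0 := mul_left_cancel₀ hm (by linarith)
  obtain rfl : b₁ = 0 := mul_left_cancel₀ hm (by linarith)
  obtain rfl : b₄ = 0 := mul_left_cancel₀ hm (by linarith)
  obtain rfl : b₅ = 0 := mul_left_cancel₀ hm (by linarith)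
  obtain rfl : b₆ = 0 := mul_left_cancel₀ hm (by linarith)
  exact hb.attainsNormalForm_of_nullRotation_coeffs hs hK hK0 hc

end Existence

section HalfTurns

variable {h : BilinForm ℝ V} {b : Module.Basis (Fin 3) ℝ V} {L M : V ≃ₗ[ℝ] V} {u v x : V}

/-- `L` is the half-turn about the line spanned by the unit spacelike vector `u`. -/
def IsHalfTurn (h : BilinForm ℝ V) (u : V) (L : V ≃ₗ[ℝ] V) : Prop :=
  h u u = 1 ∧ ∀ x, L x = (2 * h x u) • u - x

theorem IsHalfTurn.apply_self (hL : IsHalfTurn h u L) : L u = u := by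
  rw [hL.2, hL.1, mul_one, two_smul, add_sub_cancel_right]

theorem IsHalfTurn.apply_of_eq_zero (hL : IsHalfTurn h u L) (hx : h x u = 0) : L x = -x := by
  rw [hL.2, hx, mul_zero, zero_smul, zero_sub]

theorem IsHalfTurn.mul_self_eq_one (hL : IsHalfTurn h u L) : L * L = 1 := by
  ext x
  change L (L x) = x
  rw [hL.2 x, map_sub, map_smul, hL.apply_self, hL.2 x, sub_sub_cancel]

theorem IsHalfTurn.eq_smul_of_apply_eq (hL : IsHalfTurn h u L) (hx : L x = x) :
    x = h x u • u := by
  have hxx : (2 : ℝ) • x = (2 : ℝ) • h x u • u := by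
    rw [smul_smul, two_smul, ← eq_sub_iff_add_eq, ← hL.2, hx]
  exact smul_right_injective V two_ne_zero hxx

theorem IsHalfTurn.eq_of_smul {t : ℝ} (hL : IsHalfTurn h (t • u) L) (hM : IsHalfTurn h u M) :
    L = M := by
  have ht : t * t = 1 := by
    have := hL.1
    rwa [map_smul, LinearMap.map_smul₂, hM.1, smul_eq_mul, smul_eq_mul, mul_one] at this
  ext x
  rw [hL.2, hM.2, map_smul, smul_eq_mul, smul_smul, mul_assoc, mul_right_comm, ht, one_mul]

theorem IsHalfTurn.eq_or_orthogonal_of_commute (hL : IsHalfTurn h u L) (hM : IsHalfTurn h v M)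
    (hcomm : L * M = M * L) : L = M ∨ h u v = 0 := by
  have hLM : L (M u) = M u := by
    rw [← LinearEquiv.mul_apply, hcomm, LinearEquiv.mul_apply, hL.apply_self]
  have hMu := hL.eq_smul_of_apply_eq hLM
  by_cases hc : h u v = 0
  · exact Or.inr hc
  · refine Or.inl (Eq.symm ?_)
    have hv : v = ((2 * h u v)⁻¹ * (h (M u) u + 1)) • u := by
      rw [mul_smul, add_smul, one_smul, ← hMu, hM.2, sub_add_cancel,
        inv_smul_smul₀ (mul_ne_zero two_ne_zero hc)]
    rw [hv] at hM
    exact hM.eq_of_smul hL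

theorem IsONB.exists_timelike_orthogonal (hs : h.IsSymm) (hb : IsONB h b) (hu : h u u = 1)
    (hv : h v v = 1) (huv : h u v = 0) : ∃ x, h x x = -1 ∧ h x u = 0 ∧ h x v = 0 := by
  obtain ⟨b, hb, rfl⟩ := hb.exists_apply_one_eq hs hu
  obtain ⟨p, q, r, rfl⟩ := exists_coords b v
  have hq := hb.apply_eq hs 0 1 0 p q r
  simp only [zero_smul, one_smul, zero_add, add_zero, huv, zero_mul, one_mul, neg_zero] at hq
  subst hq
  rw [hb.apply_eq hs] at hv
  refine ⟨r • b 0 + (0 : ℝ) • b 1 + p • b 2, ?_, ?_, ?_⟩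
  · rw [hb.apply_eq hs]
    linarith
  · rw [← hs.eq]
    simpa using hb.apply_eq hs 0 1 0 r 0 p
  · rw [hb.apply_eq hs]
    ring

end HalfTurns

section ExistenceOfNormalForms

variable {h : BilinForm ℝ V} {K : V →ₗ[ℝ] V →ₗ[ℝ] V} {b : Module.Basis (Fin 3) ℝ V}
  {L M : V ≃ₗ[ℝ] V} {u : V}

theorem IsLVB.isHalfTurn_of_matC_neg_one (hs : h.IsSymm) (hb : IsLVB h b)
    (hL : L ∈ represented b (matC (-1))) : IsHalfTurn h (b 1) L := by
  refine ⟨hb.2.2.2.2.2, fun x => ?_⟩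
  obtain ⟨h0, h1, h2⟩ := mem_represented_matC_iff.1 hL
  obtain ⟨p, q, r, rfl⟩ := exists_coords b x
  have hq : h (p • b 0 + q • b 1 + r • b 2) (b 1) = q := by
    simpa using hb.apply_eq hs p q r 0 1 0
  rw [one_div_neg_one_eq_neg_one] at h2
  rw [hq, map_coords]
  simp only [Module.Basis.map_apply, h0, h1, h2]
  module

theorem IsONB.mem_represented_of_isHalfTurn (hs : h.IsSymm) (hb : IsONB h b)
    (hL : IsHalfTurn h (b 1) L) : L ∈ represented b (axialMat (-1) 1 0) := by
  obtain ⟨-, -, -, h01, -, h12⟩ := hb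
  rw [mem_represented_axialMat_iff, hL.apply_of_eq_zero h01, hL.apply_self,
    hL.apply_of_eq_zero (hs.eq (b 1) (b 2) ▸ h12)]
  simp

theorem IsONB.exists_isHalfTurn (hs : h.IsSymm) (hK : IsTracelessCubic h K) (hK0 : K ≠ 0)
    (hb : IsONB h b) (hno : ¬AttainsNormalForm h K) (hL : L ∈ cubicStabilizer h K) (hL1 : L ≠ 1) :
    ∃ u, IsHalfTurn h u L := by
  have hodd : Odd (Module.finrank ℝ V) := by
    rw [Module.finrank_eq_card_basis b]
    decide
  obtain ⟨x, hLx, hx | hx | ⟨hx, hx0⟩⟩ :=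
    exists_fixed_unit_or_lightlike (hb.separatingLeft hs) hodd hL.1
  · obtain ⟨b, hb, rfl⟩ := hb.exists_apply_zero_eq hs hx
    exact absurd (hb.attainsNormalForm_of_apply_timelike_eq hs hK hL hL1 hLx) hno
  · obtain ⟨b, hb, rfl⟩ := hb.exists_isLVB_apply_one_eq hs hx
    obtain ⟨l, hl, hmem⟩ := hb.exists_matC_of_apply_spacelike_eq hs hL.1 hLx
    have hl1 : l ^ 2 = 1 := by_contra fun hl1 =>
      hno (hb.attainsNormalForm_of_matC hs hK hK0 hl hl1 hL hmem)
    rcases sq_eq_one_iff.1 hl1 with rfl | rfl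
    · exact absurd (mem_represented_one_iff.1 (matC_one ▸ hmem)) hL1
    · exact ⟨b 1, hb.isHalfTurn_of_matC_neg_one hs hmem⟩
  · obtain ⟨b, hb, rfl⟩ := hb.exists_isLVB_apply_zero_eq hs hx hx0
    obtain ⟨m, hmem⟩ := hb.exists_matN_of_apply_lightlike_eq hs hL.1 hLx
    refine absurd (hb.attainsNormalForm_of_matN hs hK hK0 ?_ hL hmem) hno
    rintro rfl
    exact hL1 (mem_represented_one_iff.1 (matN_zero ▸ hmem))

/- Two half-turns whose product is again a half-turn commute, so if they are different their axes
are orthogonal and the product fixes a timelike vector. -/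
theorem IsONB.eq_of_mem_cubicStabilizer (hs : h.IsSymm) (hK : IsTracelessCubic h K) (hK0 : K ≠ 0)
    (hb : IsONB h b) (hno : ¬AttainsNormalForm h K) (hL : L ∈ cubicStabilizer h K) (hL1 : L ≠ 1)
    (hM : M ∈ cubicStabilizer h K) (hM1 : M ≠ 1) : L = M := by
  obtain ⟨u, hu⟩ := hb.exists_isHalfTurn hs hK hK0 hno hL hL1
  obtain ⟨v, hv⟩ := hb.exists_isHalfTurn hs hK hK0 hno hM hM1
  by_contra hne
  have hLM1 : L * M ≠ 1 := fun hLM => hne (mul_right_cancel (hLM.trans hv.mul_self_eq_one.symm))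
  have hLM := mul_mem hL hM
  obtain ⟨w, hw⟩ := hb.exists_isHalfTurn hs hK hK0 hno hLM hLM1
  have hcomm : L * M = M * L := by
    rw [← inv_eq_of_mul_eq_one_right hw.mul_self_eq_one, mul_inv_rev,
      inv_eq_of_mul_eq_one_right hu.mul_self_eq_one, inv_eq_of_mul_eq_one_right hv.mul_self_eq_one]
  have huv := (hu.eq_or_orthogonal_of_commute hv hcomm).resolve_left hne
  obtain ⟨x, hx, hxu, hxv⟩ := hb.exists_timelike_orthogonal hs hu.1 hv.1 huv
  obtain ⟨b, hb, rfl⟩ := hb.exists_apply_zero_eq hs hx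
  refine hno (hb.attainsNormalForm_of_apply_timelike_eq hs hK hLM hLM1 ?_)
  rw [LinearEquiv.mul_apply, hv.apply_of_eq_zero hxv, map_neg, hu.apply_of_eq_zero hxu, neg_neg]

theorem IsONB.exists_halfTurn_coeffs (hs : h.IsSymm) (hK : IsTracelessCubic h K)
    (hb : IsONB h b) (hL : L ∈ cubicStabilizer h K) (hu : IsHalfTurn h u L) :
    ∃ b' a₂ a₅ a₆, 0 ≤ a₆ ∧ IsONB h b' ∧ HasONBCoeffs K b' 0 a₂ 0 0 a₅ a₆ 0 := by
  obtain ⟨b, hb, rfl⟩ := hb.exists_apply_one_eq hs hu.1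
  obtain ⟨a₁, a₂, a₃, a₄, a₅, a₆, a₇, ha⟩ :
      ∃ a₁ a₂ a₃ a₄ a₅ a₆ a₇, HasONBCoeffs K b a₁ a₂ a₃ a₄ a₅ a₆ a₇ :=
    ⟨_, _, _, _, _, _, _, hK.hasONBCoeffs hs hb⟩
  obtain ⟨e1, -, e3, e4, -, -, e7⟩ := (hb.mem_cubicStabilizer_iff_of_axial hs hK ha (by norm_num)
    (by norm_num) (hb.mem_represented_of_isHalfTurn hs hu)).1 hL
  obtain rfl : a₁ = 0 := by linarith
  obtain rfl : a₃ = 0 := by linarith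
  obtain rfl : a₄ = 0 := by linarith
  obtain rfl : a₇ = 0 := by linarith
  rcases le_total 0 a₆ with h6 | h6
  · exact ⟨b, a₂, a₅, a₆, h6, hb, ha⟩
  · obtain ⟨b', hb', ha'⟩ := hb.exists_axial_coeffs hs hK ha (ε := 1) (c := -1) (s := 0)
      (by norm_num) (by norm_num)
    refine ⟨b', -a₂, a₅, -a₆, neg_nonneg.2 h6, hb', ?_⟩
    convert ha' using 1 <;> ring

theorem IsONB.attainsNormalForm (hs : h.IsSymm) (hb : IsONB h b) (hK : IsTracelessCubic h K)
    (hstab : ∃ L ∈ cubicStabilizer h K, L ≠ 1) : AttainsNormalForm h K := by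
  by_cases hK0 : K = 0
  · exact attainsNormalForm_of_hasNormalForm hs hK .zero hb hK0 nofun nofun
  by_contra hno
  obtain ⟨L, hL, hL1⟩ := hstab
  obtain ⟨u, hu⟩ := hb.exists_isHalfTurn hs hK hK0 hno hL hL1
  obtain ⟨b, a₂, a₅, a₆, h6, hb, ha⟩ := hb.exists_halfTurn_coeffs hs hK hL hu
  by_cases h26 : (a₂, a₆) = (0, 0)
  · obtain ⟨rfl, rfl⟩ := Prod.mk.inj h26
    exact hno (hb.attainsNormalForm_of_biaxial hs hK ha)
  have hform : HasNormalForm K b .z2B := ⟨a₂, a₅, a₆, h6, h26, ha⟩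
  obtain ⟨B, hB⟩ := exists_mem_represented_axialMat b (ε := -1) (c := 1) (s := 0) (by norm_num)
    (by norm_num)
  have hB1 : B ≠ 1 := by
    rintro rfl
    have hone : axialMat (-1) 1 0 = 1 := hB.symm.trans (mem_represented_one_iff.2 rfl)
    linarith [show (-1 : ℝ) = 1 from congrFun₂ hone 0 0]
  rw [← matB_eq_axialMat] at hB
  refine hno ⟨.z2B, b, hb, hform, subset_antisymm (fun M hM => ?_)
    (symmetrySet_subset_cubicStabilizer hs hK hb hform)⟩
  by_cases hM1 : M = 1
  · rw [hM1]
    exact one_mem (Subgroup.closure _)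
  · rw [hb.eq_of_mem_cubicStabilizer hs hK hK0 hno hM hM1
      (hb.represented_matB_subset hs hK ha hB) hB1]
    exact Subgroup.subset_closure hB

end ExistenceOfNormalForms

section ContinuousGroups

section MatrixRepresentations

variable {ι G : Type*} [Fintype ι] [DecidableEq ι] [Group G]

/-- The automorphisms of `V` whose matrices in the basis `b` are given by a matrix
representation `f`. -/
noncomputable def autOfMatrixHom (b : Module.Basis ι ℝ V) (f : G →* Matrix ι ι ℝ) :
    G →* (V ≃ₗ[ℝ] V) :=
  (LinearMap.GeneralLinearGroup.generalLinearEquiv ℝ V).toMonoidHom.comp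
    ((Units.map (LinearMap.toMatrixAlgEquiv b).symm.toMonoidHom).comp f.toHomUnits)

theorem eq_autOfMatrixHom_iff {b : Module.Basis ι ℝ V} {f : G →* Matrix ι ι ℝ} {g : G}
    {L : V ≃ₗ[ℝ] V} :
    L = autOfMatrixHom b f g ↔ LinearMap.toMatrix b b (L : V →ₗ[ℝ] V) = f g := by
  rw [← LinearEquiv.toLinearMap_inj]
  exact (LinearMap.toMatrixAlgEquiv b).eq_symm_apply

theorem autOfMatrixHom_injective (b : Module.Basis ι ℝ V) {f : G →* Matrix ι ι ℝ}
    (hf : Function.Injective f) : Function.Injective (autOfMatrixHom b f) := fun _ _ hgg' =>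
  hf ((eq_autOfMatrixHom_iff.1 rfl).symm.trans (eq_autOfMatrixHom_iff.1 hgg'))

theorem nonempty_mulEquiv_of_mem_iff_toMatrix_eq (b : Module.Basis ι ℝ V)
    {f : G →* Matrix ι ι ℝ} (hf : Function.Injective f) {S : Subgroup (V ≃ₗ[ℝ] V)}
    (hS : ∀ L : V ≃ₗ[ℝ] V, L ∈ S ↔ ∃ g, LinearMap.toMatrix b b (L : V →ₗ[ℝ] V) = f g) :
    Nonempty (S ≃* G) := by
  have hrange : S = (autOfMatrixHom b f).range := by
    ext L
    simp only [hS, MonoidHom.mem_range, eq_comm (b := L), eq_autOfMatrixHom_iff]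
  rw [hrange]
  exact ⟨(MonoidHom.ofInjective (autOfMatrixHom_injective b hf)).symm⟩

end MatrixRepresentations

theorem nonempty_closure_image_mulEquiv {G H : Type*} [Group G] [Group H] {f : G →* H}
    (hf : Function.Injective f) {s : Set G} (hs : Subgroup.closure s = ⊤) :
    Nonempty (Subgroup.closure (f '' s) ≃* G) := by
  rw [← MonoidHom.map_closure, hs, ← MonoidHom.range_eq_map]
  exact ⟨(MonoidHom.ofInjective hf).symm⟩

theorem conj_mem_specialIsometryGroup {W : Type*} [AddCommGroup W] [Module ℝ W]
    {h : BilinForm ℝ V} {h' : BilinForm ℝ W} (e : V ≃ₗ[ℝ] W)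
    (he : ∀ x y, h' (e x) (e y) = h x y) {L : V ≃ₗ[ℝ] V} (hL : L ∈ specialIsometryGroup h) :
    e.symm ≪≫ₗ L ≪≫ₗ e ∈ specialIsometryGroup h' := by
  refine ⟨fun x y => ?_, (LinearMap.det_conj (L : V →ₗ[ℝ] V) e).trans hL.2⟩
  simp only [LinearEquiv.trans_apply]
  rw [he, hL.1, ← he, e.apply_symm_apply, e.apply_symm_apply]

theorem nonempty_specialIsometryGroup_mulEquiv {W : Type*} [AddCommGroup W] [Module ℝ W]
    {h : BilinForm ℝ V} {h' : BilinForm ℝ W} (e : V ≃ₗ[ℝ] W)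
    (he : ∀ x y, h' (e x) (e y) = h x y) :
    Nonempty (specialIsometryGroup h ≃* specialIsometryGroup h') := by
  have he' : ∀ x y, h (e.symm x) (e.symm y) = h' x y := fun x y => by
    rw [← he, e.apply_symm_apply, e.apply_symm_apply]
  exact ⟨{
    toFun L := ⟨_, conj_mem_specialIsometryGroup e he L.2⟩
    invFun L := ⟨_, conj_mem_specialIsometryGroup e.symm he' L.2⟩
    left_inv L := by ext; simp
    right_inv L := by ext; simp
    map_mul' L M := by ext; simp }⟩

/-- `SO(2)` acting on the last two coordinates. -/
def rotationHom : Matrix.specialOrthogonalGroup (Fin 2) ℝ →* Matrix (Fin 3) (Fin 3) ℝ where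
  toFun A := !![1, 0, 0; 0, A.1 0 0, A.1 0 1; 0, A.1 1 0, A.1 1 1]
  map_one' := by simp [Matrix.one_fin_three]
  map_mul' A B := by
    ext i j
    fin_cases i <;> fin_cases j <;> simp [Matrix.mul_apply, Fin.sum_univ_three, Fin.sum_univ_two]

theorem exists_matA_eq_rotationHom (θ : ℝ) : ∃ A, matA θ = rotationHom A :=
  ⟨⟨!![Real.cos θ, -Real.sin θ; Real.sin θ, Real.cos θ],
    Matrix.of_mem_specialOrthogonalGroup_fin_two_iff.2 ⟨rfl, rfl, by
      rw [neg_sq]; exact Real.cos_sq_add_sin_sq _⟩⟩, rfl⟩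

theorem exists_rotationHom_eq_matA (A : Matrix.specialOrthogonalGroup (Fin 2) ℝ) :
    ∃ θ, rotationHom A = matA θ := by
  obtain ⟨hdiag, hoff, hsq⟩ := Matrix.mem_specialOrthogonalGroup_fin_two_iff.1 A.2
  obtain ⟨θ, hc, hs⟩ := exists_cos_eq_and_sin_eq (c := A.1 0 0) (s := A.1 1 0)
    (by rwa [hoff, neg_sq] at hsq)
  exact ⟨θ, by simp [rotationHom, matA, hc, hs, hoff, hdiag]⟩

theorem rotationHom_injective : Function.Injective rotationHom := fun A B hAB => by
  have key := congrFun₂ hAB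
  ext i j
  fin_cases i <;> fin_cases j
  exacts [key 1 1, key 1 2, key 2 1, key 2 2]

/-- The boosts `matC` as a homomorphism. -/
noncomputable def matCHom : ℝˣ →* Matrix (Fin 3) (Fin 3) ℝ where
  toFun l := matC l
  map_one' := matC_one
  map_mul' l m := by
    ext i j
    fin_cases i <;> fin_cases j <;> simp [matC, Matrix.mul_apply, Fin.sum_univ_three, mul_comm]

theorem matCHom_injective : Function.Injective matCHom := fun _ _ hlm =>
  Units.ext (congrFun₂ hlm 0 0)

/-- The null rotations `matN` as a homomorphism. -/
noncomputable def matNHom : Multiplicative ℝ →* Matrix (Fin 3) (Fin 3) ℝ where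
  toFun m := matN m.toAdd
  map_one' := matN_zero
  map_mul' m n := by
    ext i j
    fin_cases i <;> fin_cases j <;> simp [matN, Matrix.mul_apply, Fin.sum_univ_three] <;> ring

theorem matNHom_injective : Function.Injective matNHom := fun _ _ hmn =>
  congrFun₂ hmn 1 2

/-- The Lorentz boosts of the plane, parametrized by their eigenvalue on the lightlike vector
`(1, 1)`. -/
noncomputable def boostHom : ℝˣ →* Matrix (Fin 2) (Fin 2) ℝ where
  toFun l := !![(l + (l : ℝ)⁻¹) / 2, (l - (l : ℝ)⁻¹) / 2; (l - (l : ℝ)⁻¹) / 2, (l + (l : ℝ)⁻¹) / 2]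
  map_one' := by simp [Matrix.one_fin_two]
  map_mul' l m := by
    rw [Matrix.mul_fin_two, Units.val_mul, mul_inv]
    ext i j
    fin_cases i <;> fin_cases j <;> simp <;> ring

theorem boostHom_injective : Function.Injective boostHom := fun l m hlm => by
  have h0 : ((l : ℝ) + (l : ℝ)⁻¹) / 2 = (m + (m : ℝ)⁻¹) / 2 := congrFun₂ hlm 0 0
  have h1 : ((l : ℝ) - (l : ℝ)⁻¹) / 2 = (m - (m : ℝ)⁻¹) / 2 := congrFun₂ hlm 0 1
  exact Units.ext (by linarith)

theorem lorentzForm_one_apply (x y : Fin 2 → ℝ) :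
    lorentzForm 1 x y = -(x 0 * y 0) + x 1 * y 1 := by
  simp [lorentzForm, Matrix.toBilin'_apply, Fin.sum_univ_two, Matrix.diagonal]

theorem mem_SO1_one_iff {L : (Fin 2 → ℝ) ≃ₗ[ℝ] (Fin 2 → ℝ)} :
    L ∈ SO1 1 ↔ ∃ p q : ℝ, p ^ 2 - q ^ 2 = 1 ∧
      LinearMap.toMatrix' (L : (Fin 2 → ℝ) →ₗ[ℝ] (Fin 2 → ℝ)) = !![p, q; q, p] := by
  change (_ ∧ _) ↔ _
  have hdet := LinearMap.det_toMatrix' (L : (Fin 2 → ℝ) →ₗ[ℝ] (Fin 2 → ℝ))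
  have happly (x : Fin 2 → ℝ) : L x = (LinearMap.toMatrix' (L : (Fin 2 → ℝ) →ₗ[ℝ] _)).mulVec x :=
    (LinearMap.toMatrix'_mulVec _ x).symm
  simp only [← hdet, happly, lorentzForm_one_apply]
  clear hdet happly
  generalize LinearMap.toMatrix' (L : (Fin 2 → ℝ) →ₗ[ℝ] (Fin 2 → ℝ)) = A
  simp only [Matrix.mulVec, dotProduct, Fin.sum_univ_two, Matrix.det_fin_two]
  constructor
  · rintro ⟨hA, hdet⟩
    have h00 := hA ![1, 0] ![1, 0]
    have h01 := hA ![1, 0] ![0, 1]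
    simp only [Matrix.cons_val_zero, Matrix.cons_val_one, mul_one, mul_zero, add_zero,
      zero_add, neg_zero] at h00 h01
    have h11 : A 1 1 = A 0 0 := by linear_combination A 0 0 * hdet + A 1 1 * h00 - A 1 0 * h01
    have h10 : A 0 1 = A 1 0 := by linear_combination A 1 0 * hdet + A 0 1 * h00 - A 0 0 * h01
    refine ⟨A 0 0, A 1 0, by linear_combination -h00, ?_⟩
    rw [A.eta_fin_two, h11, h10]
    rfl
  · rintro ⟨p, q, hpq, rfl⟩
    simp only [Matrix.of_apply, Matrix.cons_val]
    exact ⟨fun x y => by linear_combination (x 1 * y 1 - x 0 * y 0) * hpq,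
      by linear_combination hpq⟩

theorem exists_boostHom_eq_iff {A : Matrix (Fin 2) (Fin 2) ℝ} :
    (∃ l, A = boostHom l) ↔ ∃ p q : ℝ, p ^ 2 - q ^ 2 = 1 ∧ A = !![p, q; q, p] := by
  constructor
  · rintro ⟨l, rfl⟩
    have := l.ne_zero
    exact ⟨_, _, by field_simp; ring, rfl⟩
  · rintro ⟨p, q, hpq, rfl⟩
    have hinv : (p + q) * (p - q) = 1 := by linear_combination hpq
    refine ⟨⟨p + q, p - q, hinv, by rw [mul_comm, hinv]⟩, ?_⟩
    simp [boostHom, inv_eq_of_mul_eq_one_right hinv]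

end ContinuousGroups

section FiniteGroups

variable {b : Module.Basis (Fin 3) ℝ V}

theorem pow_mem_represented {L : V ≃ₗ[ℝ] V} {A : Matrix (Fin 3) (Fin 3) ℝ}
    (hL : L ∈ represented b A) (n : ℕ) : L ^ n ∈ represented b (A ^ n) := by
  induction n with
  | zero => exact mem_represented_one_iff.2 rfl
  | succ n ih => exact mul_mem_represented ih hL

theorem nonempty_closure_represented_mulEquiv (b : Module.Basis (Fin 3) ℝ V) {p : ℕ}
    [hp : Fact p.Prime] {A : Matrix (Fin 3) (Fin 3) ℝ} (hone : A ≠ 1) (hpow : A ^ p = 1) :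
    Nonempty (Subgroup.closure (represented b A) ≃* Multiplicative (ZMod p)) := by
  obtain ⟨L, hL⟩ := exists_mem_represented b
    ((Matrix.isUnit_iff_isUnit_det A).1 (IsUnit.of_pow_eq_one hpow hp.out.ne_zero))
  have horder : orderOf L = p :=
    orderOf_eq_prime (mem_represented_one_iff.1 (hpow ▸ pow_mem_represented hL p)) <| by
      rintro rfl
      exact hone ((show _ = A from hL).symm.trans (mem_represented_one_iff.2 rfl))
  rw [(represented_subsingleton b A).eq_singleton_of_mem hL, ← Subgroup.zpowers_eq_closure]
  exact ⟨mulEquivOfPrimeCardEq (p := p) (by rw [Nat.card_zpowers, horder]) (by simp)⟩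

theorem matA_pi_sq : matA Real.pi ^ 2 = 1 := by
  rw [matA_pi_eq_axialMat, pow_two, axialMat_mul (one_pow 2), ← axialMat_one_one_zero]
  norm_num

theorem matA_two_pi_div_three_pow : matA (2 * Real.pi / 3) ^ 3 = 1 := by
  have hsqrt : √3 * √3 = (3 : ℝ) := Real.mul_self_sqrt three_pos.le
  rw [matA_two_pi_div_three_eq_axialMat, pow_succ, pow_two, axialMat_mul (one_pow 2), one_mul,
    axialMat_mul (one_pow 2), ← axialMat_one_one_zero]
  congr 1 <;> grind

theorem matB_sq : matB ^ 2 = 1 := by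
  rw [matB_eq_axialMat, pow_two, axialMat_mul (by norm_num), ← axialMat_one_one_zero]
  norm_num

theorem axialMat_ne_one {ε c s : ℝ} (h : ε ≠ 1 ∨ c ≠ 1) : axialMat ε c s ≠ 1 := fun h1 =>
  h.elim (· (congrFun₂ h1 0 0)) (· (congrFun₂ h1 1 1))

/-- The group of diagonal matrices with entries `±1` and determinant `1`. -/
noncomputable def diagonalSignHom : ℤˣ × ℤˣ →* Matrix (Fin 3) (Fin 3) ℝ where
  toFun g := axialMat (g.1 : ℤ) (g.2 : ℤ) 0
  map_one' := by simpa using axialMat_one_one_zero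
  map_mul' g g' := by
    rw [axialMat_mul (by rcases Int.units_eq_one_or g.1 with h | h <;> simp [h])]
    simp

theorem diagonalSignHom_injective : Function.Injective diagonalSignHom := fun _ _ hgg' =>
  Prod.ext (Units.ext (Int.cast_injective (α := ℝ) (congrFun₂ hgg' 0 0)))
    (Units.ext (Int.cast_injective (α := ℝ) (congrFun₂ hgg' 1 1)))

theorem represented_eq_singleton {G : Type*} [Group G]
    {f : G →* Matrix (Fin 3) (Fin 3) ℝ} (g : G) :
    represented b (f g) = {autOfMatrixHom b f g} :=
  Set.ext fun _ => eq_autOfMatrixHom_iff.symm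

theorem nonempty_closure_matA_pi_matB_mulEquiv (b : Module.Basis (Fin 3) ℝ V) :
    Nonempty (Subgroup.closure (represented b (matA Real.pi) ∪ represented b matB) ≃*
      Multiplicative (ZMod 2) × Multiplicative (ZMod 2)) := by
  have hA : matA Real.pi = diagonalSignHom (1, -1) := by
    simp [matA_pi_eq_axialMat, diagonalSignHom]
  have hB : matB = diagonalSignHom (-1, 1) := by simp [matB_eq_axialMat, diagonalSignHom]
  have hgen : Subgroup.closure {((1, -1) : ℤˣ × ℤˣ), (-1, 1)} = ⊤ := by
    rw [eq_top_iff]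
    rintro ⟨u, v⟩ -
    have h₁ := Subgroup.subset_closure (Set.mem_insert ((1, -1) : ℤˣ × ℤˣ) {(-1, 1)})
    have h₂ := Subgroup.subset_closure
      (Set.mem_insert_of_mem ((1, -1) : ℤˣ × ℤˣ) (Set.mem_singleton (-1, 1)))
    rcases Int.units_eq_one_or u with rfl | rfl <;> rcases Int.units_eq_one_or v with rfl | rfl
    exacts [one_mem _, h₁, h₂, mul_mem h₁ h₂]
  obtain ⟨e⟩ := nonempty_closure_image_mulEquiv
    (autOfMatrixHom_injective b diagonalSignHom_injective) hgen
  rw [hA, hB, represented_eq_singleton, represented_eq_singleton, Set.singleton_union,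
    ← Set.image_pair]
  have hunits : ℤˣ ≃* Multiplicative (ZMod 2) := mulEquivOfPrimeCardEq (p := 2) (by simp) (by simp)
  exact ⟨e.trans (hunits.prodCongr hunits)⟩

/-- The permutations of a basis, twisted by their signs. -/
noncomputable def signedPermHom {ι : Type*} [Fintype ι] [DecidableEq ι]
    (e : Module.Basis ι ℝ V) : Equiv.Perm ι →* (V ≃ₗ[ℝ] V) where
  toFun σ := DistribMulAction.toModuleAut ℝ V (Equiv.Perm.sign σ) * e.equiv e σ
  map_one' := by
    rw [map_one, map_one, one_mul]
    exact e.equiv_refl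
  map_mul' σ τ := by
    refine e.ext' fun i => ?_
    simpa [LinearEquiv.mul_apply, mul_smul] using smul_comm _ _ _

theorem signedPermHom_apply {ι : Type*} [Fintype ι] [DecidableEq ι]
    (e : Module.Basis ι ℝ V) (σ : Equiv.Perm ι) (i : ι) :
    signedPermHom e σ (e i) = Equiv.Perm.sign σ • e (σ i) := by
  simp [signedPermHom, LinearEquiv.mul_apply]

theorem signedPermHom_injective {ι : Type*} [Fintype ι] [DecidableEq ι]
    (e : Module.Basis ι ℝ V) : Function.Injective (signedPermHom e) := fun σ τ hστ => by
  ext i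
  by_contra hne
  have h1 := congrArg (fun L : V ≃ₗ[ℝ] V => e.repr (L (e i)) (σ i)) hστ
  rcases Int.units_eq_one_or (Equiv.Perm.sign σ) with h | h <;>
    simp [signedPermHom_apply, h, Units.smul_def, Ne.symm hne] at h1

/-- The coordinates, in an orthonormal basis `(t, v, w)`, of three lightlike vectors `t + u` with
`u` a unit vector in the plane of `v`, `w`, at mutual angles `2π/3`. -/
noncomputable def triadMat : Matrix (Fin 3) (Fin 3) ℝ :=
  !![1, 1, 1; 0, -(√3 / 2), √3 / 2; 1, -1 / 2, -1 / 2]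

theorem isUnit_det_triadMat : IsUnit triadMat.det := by
  have hdet : triadMat.det = 3 * √3 / 2 := by
    simp only [triadMat, Matrix.det_fin_three, Matrix.of_apply, Matrix.cons_val]
    ring
  rw [hdet]
  exact (by positivity : 3 * √3 / 2 ≠ 0).isUnit

/-- The basis with coordinates `triadMat`. The rotation of order three permutes it, and the
half-turn `matB` permutes it up to sign. -/
noncomputable def triadBasis (b : Module.Basis (Fin 3) ℝ V) : Module.Basis (Fin 3) ℝ V :=
  b.map (Matrix.toLinearEquiv b triadMat isUnit_det_triadMat)

theorem triadBasis_apply (b : Module.Basis (Fin 3) ℝ V) (i : Fin 3) :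
    triadBasis b i = triadMat 0 i • b 0 + triadMat 1 i • b 1 + triadMat 2 i • b 2 := by
  rw [← Fin.sum_univ_three fun j => triadMat j i • b j]
  exact Matrix.toLin_self b b triadMat i

theorem represented_matA_two_pi_div_three (b : Module.Basis (Fin 3) ℝ V) :
    represented b (matA (2 * Real.pi / 3)) = {signedPermHom (triadBasis b) (finRotate 3)} := by
  have hsqrt : √3 * √3 = (3 : ℝ) := Real.mul_self_sqrt three_pos.le
  rw [matA_two_pi_div_three_eq_axialMat]
  obtain ⟨R, hR⟩ := exists_mem_represented_axialMat b (ε := 1) (c := -1 / 2) (s := √3 / 2)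
    (one_pow 2) (by grind)
  obtain ⟨hR0, hR1, hR2⟩ := mem_represented_axialMat_iff.1 hR
  rw [(represented_subsingleton b _).eq_singleton_of_mem hR, Set.singleton_eq_singleton_iff]
  refine (triadBasis b).ext' fun i => ?_
  rw [signedPermHom_apply, show Equiv.Perm.sign (finRotate 3) = 1 by decide, one_smul,
    triadBasis_apply, triadBasis_apply, map_coords]
  simp only [Module.Basis.map_apply, hR0, hR1, hR2]
  simp only [triadMat, Matrix.of_apply, finRotate_apply]
  fin_cases i <;>
    simp only [Fin.reduceFinMk, Fin.reduceAdd, Fin.zero_eta, Fin.mk_one, Matrix.cons_val] <;>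
    match_scalars <;> grind

theorem represented_matB (b : Module.Basis (Fin 3) ℝ V) :
    represented b matB = {signedPermHom (triadBasis b) (Equiv.swap 1 2)} := by
  rw [matB_eq_axialMat]
  obtain ⟨B, hB⟩ := exists_mem_represented_axialMat b (ε := -1) (c := 1) (s := 0)
    (by norm_num) (by norm_num)
  obtain ⟨hB0, hB1, hB2⟩ := mem_represented_axialMat_iff.1 hB
  rw [(represented_subsingleton b _).eq_singleton_of_mem hB, Set.singleton_eq_singleton_iff]
  refine (triadBasis b).ext' fun i => ?_
  rw [signedPermHom_apply, Equiv.Perm.sign_swap (by decide), triadBasis_apply, triadBasis_apply,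
    map_coords]
  simp only [Module.Basis.map_apply, hB0, hB1, hB2]
  simp only [triadMat, Matrix.of_apply, Equiv.swap_apply_def]
  fin_cases i <;> simp

theorem nonempty_closure_matA_two_pi_div_three_matB_mulEquiv (b : Module.Basis (Fin 3) ℝ V) :
    Nonempty (Subgroup.closure (represented b (matA (2 * Real.pi / 3)) ∪ represented b matB) ≃*
      Equiv.Perm (Fin 3)) := by
  rw [represented_matA_two_pi_div_three, represented_matB, Set.singleton_union, ← Set.image_pair]
  exact nonempty_closure_image_mulEquiv (signedPermHom_injective _)
    (Equiv.Perm.closure_cycle_adjacent_swap isCycle_finRotate support_finRotate 1)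

end FiniteGroups

section IsomorphismTypes

variable {h : BilinForm ℝ V} {b : Module.Basis (Fin 3) ℝ V} {S : Subgroup (V ≃ₗ[ℝ] V)}

theorem lorentzForm_two_apply (x y : Fin 3 → ℝ) :
    lorentzForm 2 x y = -(x 0 * y 0) + x 1 * y 1 + x 2 * y 2 := by
  have hcons : (Fin.cons (-1) (fun _ => 1) : Fin 3 → ℝ) 2 = 1 := rfl
  simp [lorentzForm, Matrix.toBilin'_apply, Fin.sum_univ_three, Matrix.diagonal, hcons]

theorem IsONB.nonempty_specialIsometryGroup_mulEquiv (hs : h.IsSymm) (hb : IsONB h b) :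
    Nonempty (specialIsometryGroup h ≃* SO1 2) :=
  LorentzCubic.nonempty_specialIsometryGroup_mulEquiv b.equivFun fun x y => by
    obtain ⟨p, q, r, rfl⟩ := exists_coords b x
    obtain ⟨p', q', r', rfl⟩ := exists_coords b y
    rw [hb.apply_eq hs, lorentzForm_two_apply]
    simp

theorem nonempty_SO1_one_mulEquiv_units : Nonempty (SO1 1 ≃* ℝˣ) :=
  nonempty_mulEquiv_of_mem_iff_toMatrix_eq (Pi.basisFun ℝ (Fin 2)) boostHom_injective fun L => by
    rw [mem_SO1_one_iff, exists_boostHom_eq_iff, LinearMap.toMatrix_eq_toMatrix']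

theorem hasIsoType_of_coe_eq_symmetrySet (hs : h.IsSymm) {c : FormType} (hb : IsAdapted h b c)
    (hS : (S : Set (V ≃ₗ[ℝ] V)) = symmetrySet h b c) : HasIsoType S c := by
  have hmem (L : V ≃ₗ[ℝ] V) : L ∈ S ↔ L ∈ symmetrySet h b c := by rw [← hS, SetLike.mem_coe]
  cases c with
  | zero =>
    obtain rfl : S = specialIsometryGroup h := SetLike.coe_injective hS
    exact IsONB.nonempty_specialIsometryGroup_mulEquiv hs hb
  | so2 =>
    refine nonempty_mulEquiv_of_mem_iff_toMatrix_eq b rotationHom_injective fun L =>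
      (hmem L).trans ⟨fun ⟨θ, hL⟩ => ?_, fun ⟨A, hL⟩ => ?_⟩
    · exact (exists_matA_eq_rotationHom θ).imp fun _ h => hL.trans h
    · exact (exists_rotationHom_eq_matA A).imp fun _ h => hL.trans h
  | s3 =>
    obtain rfl := SetLike.coe_injective hS
    exact nonempty_closure_matA_two_pi_div_three_matB_mulEquiv b
  | z3 =>
    obtain rfl := SetLike.coe_injective hS
    have : Fact (Nat.Prime 3) := ⟨Nat.prime_three⟩
    refine nonempty_closure_represented_mulEquiv b ?_ matA_two_pi_div_three_pow
    exact matA_two_pi_div_three_eq_axialMat ▸ axialMat_ne_one (Or.inr (by norm_num))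
  | z2B =>
    obtain rfl := SetLike.coe_injective hS
    refine nonempty_closure_represented_mulEquiv b ?_ matB_sq
    exact matB_eq_axialMat ▸ axialMat_ne_one (Or.inl (by norm_num))
  | z2z2 =>
    obtain rfl := SetLike.coe_injective hS
    exact nonempty_closure_matA_pi_matB_mulEquiv b
  | z2A =>
    obtain rfl := SetLike.coe_injective hS
    refine nonempty_closure_represented_mulEquiv b ?_ matA_pi_sq
    exact matA_pi_eq_axialMat ▸ axialMat_ne_one (Or.inr (by norm_num))
  | so11 =>
    obtain ⟨e⟩ := nonempty_mulEquiv_of_mem_iff_toMatrix_eq b matCHom_injective fun L =>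
      (hmem L).trans ⟨fun ⟨l, hl, hL⟩ => ⟨Units.mk0 l hl, hL⟩, fun ⟨l, hL⟩ => ⟨l, l.ne_zero, hL⟩⟩
    exact nonempty_SO1_one_mulEquiv_units.map fun e' => e.trans e'.symm
  | real =>
    exact nonempty_mulEquiv_of_mem_iff_toMatrix_eq b matNHom_injective fun L =>
      (hmem L).trans ⟨fun ⟨m, hL⟩ => ⟨Multiplicative.ofAdd m, hL⟩, fun ⟨m, hL⟩ => ⟨m.toAdd, hL⟩⟩

end IsomorphismTypes

section Uniqueness

variable {h : BilinForm ℝ V} {K : V →ₗ[ℝ] V →ₗ[ℝ] V} {b : Module.Basis (Fin 3) ℝ V}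
  {L : V ≃ₗ[ℝ] V} {c c' : FormType}

theorem HasNormalForm.formType_eq_zero (H : HasNormalForm K b c) (hK : K = 0) :
    c = .zero := by
  subst hK
  have hONB : HasONBCoeffs (0 : V →ₗ[ℝ] V →ₗ[ℝ] V) b 0 0 0 0 0 0 0 := by
    simp [HasONBCoeffs, ← Matrix.ext_iff, Fin.forall_fin_succ]
  have hLVB : HasLVBCoeffs (0 : V →ₗ[ℝ] V →ₗ[ℝ] V) b 0 0 0 0 0 0 0 := by
    simp [HasLVBCoeffs, ← Matrix.ext_iff, Fin.forall_fin_succ]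
  cases c with
  | zero => rfl
  | so2 | s3 | z2z2 =>
    obtain ⟨a, ha, hco⟩ := H
    obtain ⟨-, -, -, h4, h5, h6, -⟩ := hco.unique hONB
    exact absurd ‹a = 0› ha.ne'
  | z3 =>
    obtain ⟨a₄, a₆, h4, -, hco⟩ := H
    exact absurd (hco.unique hONB).2.2.2.1 h4.ne'
  | z2B =>
    obtain ⟨a₂, a₅, a₆, -, hne, hco⟩ := H
    obtain ⟨-, h2, -, -, -, h6, -⟩ := hco.unique hONB
    exact absurd (Prod.ext h2 h6) hne
  | z2A =>
    obtain ⟨a₁, a₄, -, hne, hco⟩ := H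
    obtain ⟨h1, -, -, h4, -⟩ := hco.unique hONB
    exact absurd (by linarith) hne
  | so11 | real =>
    obtain ⟨a, ha, hco⟩ := H
    obtain ⟨-, -, -, h4, -, -, h7⟩ := hco.unique hLVB
    exact absurd ‹a = 0› ha.ne'

/-- The order of the symmetry group of a nonzero normal form, with `0` for an infinite group
as in `Nat.card`. -/
def FormType.order : FormType → ℕ
  | .s3 => 6
  | .z3 => 3
  | .z2B | .z2A => 2
  | .z2z2 => 4
  | .zero | .so2 | .so11 | .real => 0

theorem infinite_specialOrthogonalGroup_two :
    Infinite (Matrix.specialOrthogonalGroup (Fin 2) ℝ) := by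
  have : Infinite (Set.Icc (-1 : ℝ) 1) := (Set.Icc_infinite (by norm_num)).to_subtype
  refine Infinite.of_injective (fun t : Set.Icc (-1 : ℝ) 1 =>
    ⟨!![t, -√(1 - t ^ 2); √(1 - t ^ 2), t],
      Matrix.of_mem_specialOrthogonalGroup_fin_two_iff.2 ⟨rfl, rfl, ?_⟩⟩)
    fun t t' htt' => Subtype.ext (congrFun₂ (congrArg Subtype.val htt') 0 0)
  rw [neg_sq, Real.sq_sqrt (sub_nonneg.2 (sq_le_one_iff_abs_le_one _ |>.2 (abs_le.2 t.2)))]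
  ring

theorem infinite_units_real : Infinite ℝˣ :=
  Infinite.of_injective (fun n : ℕ => Units.mk0 (n + 1 : ℝ) n.cast_add_one_ne_zero)
    fun m n hmn => by simpa using congrArg Units.val hmn

theorem HasIsoType.card_eq_order {G : Type*} [Group G] (H : HasIsoType G c) (hc : c ≠ .zero) :
    Nat.card G = c.order := by
  cases c with
  | zero => exact absurd rfl hc
  | so2 =>
    have := infinite_specialOrthogonalGroup_two
    exact H.elim fun e => (Nat.card_congr e.toEquiv).trans Nat.card_eq_zero_of_infinite
  | so11 =>
    have := infinite_units_real
    exact H.elim fun e => nonempty_SO1_one_mulEquiv_units.elim fun e' =>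
      (Nat.card_congr (e.trans e').toEquiv).trans Nat.card_eq_zero_of_infinite
  | real => exact H.elim fun e => (Nat.card_congr e.toEquiv).trans Nat.card_eq_zero_of_infinite
  | s3 =>
    obtain ⟨e⟩ := H
    rw [Nat.card_congr e.toEquiv, Nat.card_perm, Nat.card_fin]
    rfl
  | z3 | z2B | z2z2 | z2A =>
    exact H.elim fun e => (Nat.card_congr e.toEquiv).trans (by simp [FormType.order])

/-- The fixed vectors of `L` form the line spanned by the nonzero vector `x`. -/
def IsAxis (L : V ≃ₗ[ℝ] V) (x : V) : Prop :=
  x ≠ 0 ∧ ∀ y, L y = y ↔ y ∈ Submodule.span ℝ {x}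

theorem IsAxis.sign_apply_self_eq {x y : V} (hx : IsAxis L x) (hy : IsAxis L y) :
    SignType.sign (h x x) = SignType.sign (h y y) := by
  obtain ⟨r, rfl⟩ := Submodule.mem_span_singleton.1
    ((hx.2 y).1 ((hy.2 y).2 (Submodule.mem_span_singleton_self y)))
  have hr : r ≠ 0 := fun hr => hy.1 (by rw [hr, zero_smul])
  rw [(h (r • x)).map_smul, h.map_smul, LinearMap.smul_apply, smul_smul, smul_eq_mul, sign_mul,
    sign_pos (mul_self_pos.2 hr), one_mul]

theorem isAxis_of_apply_eq {i : Fin 3} (hi : L (b i) = b i)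
    (hfix : ∀ y, L y = y → y ∈ Submodule.span ℝ {b i}) : IsAxis L (b i) := by
  refine ⟨b.ne_zero i, fun y => ⟨hfix y, fun hy => ?_⟩⟩
  obtain ⟨r, rfl⟩ := Submodule.mem_span_singleton.1 hy
  rw [map_smul, hi]

theorem IsONB.isAxis_of_apply_timelike_eq (hs : h.IsSymm) (hb : IsONB h b)
    (hL : L ∈ specialIsometryGroup h) (hL1 : L ≠ 1) (h0 : L (b 0) = b 0) : IsAxis L (b 0) := by
  obtain ⟨c, s, -, hcs, hmem⟩ :=
    hb.exists_axial_of_apply_timelike_eq_smul hs hL (ε := 1) (by rw [h0, one_smul])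
  have hc : c ≠ 1 := by
    rintro rfl
    obtain rfl : s = 0 := by simpa using hcs
    exact hL1 (mem_represented_axialMat_one_iff.1 hmem)
  obtain ⟨-, h1, h2⟩ := mem_represented_axialMat_iff.1 hmem
  refine isAxis_of_apply_eq h0 fun y hy => ?_
  obtain ⟨p, q, r, rfl⟩ := exists_coords b y
  have hfix : p • b 0 + (c * q - s * r) • b 1 + (c * r + s * q) • b 2 =
      p • b 0 + q • b 1 + r • b 2 := by
    rw [← hy]
    simp only [map_add, map_smul, h0, h1, h2]
    module
  obtain ⟨-, hq, hr⟩ := coords_inj.1 hfix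
  obtain ⟨rfl, rfl⟩ := eq_zero_of_rotation_fixed hcs hc hr hq
  exact Submodule.mem_span_singleton.2 ⟨p, by simp⟩

theorem IsLVB.isAxis_of_apply_spacelike_eq (hs : h.IsSymm) (hb : IsLVB h b)
    (hL : L ∈ specialIsometryGroup h) (hL1 : L ≠ 1) (h1 : L (b 1) = b 1) : IsAxis L (b 1) := by
  obtain ⟨l, hl, hmem⟩ := hb.exists_matC_of_apply_spacelike_eq hs hL h1
  have hl1 : l ≠ 1 := by
    rintro rfl
    exact hL1 (mem_represented_one_iff.1 (matC_one ▸ hmem))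
  obtain ⟨h0, -, h2⟩ := mem_represented_matC_iff.1 hmem
  refine isAxis_of_apply_eq h1 fun y hy => ?_
  obtain ⟨p, q, r, rfl⟩ := exists_coords b y
  have hfix : (l * p) • b 0 + q • b 1 + (1 / l * r) • b 2 = p • b 0 + q • b 1 + r • b 2 := by
    rw [← hy]
    simp only [map_add, map_smul, h0, h1, h2]
    module
  obtain ⟨hp, -, hr⟩ := coords_inj.1 hfix
  obtain rfl : p = 0 := (mul_left_eq_self₀.1 hp).resolve_left hl1
  obtain rfl : r = 0 :=
    (mul_left_eq_self₀.1 hr).resolve_left (by rwa [div_eq_one_iff_eq hl, eq_comm])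
  exact Submodule.mem_span_singleton.2 ⟨q, by simp⟩

theorem IsLVB.isAxis_of_apply_lightlike_eq (hs : h.IsSymm) (hb : IsLVB h b)
    (hL : L ∈ specialIsometryGroup h) (hL1 : L ≠ 1) (h0 : L (b 0) = b 0) : IsAxis L (b 0) := by
  obtain ⟨m, hmem⟩ := hb.exists_matN_of_apply_lightlike_eq hs hL h0
  have hm : m ≠ 0 := by
    rintro rfl
    exact hL1 (mem_represented_one_iff.1 (matN_zero ▸ hmem))
  obtain ⟨-, h1, h2⟩ := mem_represented_matN_iff.1 hmem
  refine isAxis_of_apply_eq h0 fun y hy => ?_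
  obtain ⟨p, q, r, rfl⟩ := exists_coords b y
  have hfix : (p - m * q - m ^ 2 / 2 * r) • b 0 + (q + m * r) • b 1 + r • b 2 =
      p • b 0 + q • b 1 + r • b 2 := by
    rw [← hy]
    simp only [map_add, map_smul, h0, h1, h2]
    module
  obtain ⟨hp, hq, -⟩ := coords_inj.1 hfix
  obtain rfl : r = 0 := by simpa [hm] using hq
  obtain rfl : q = 0 := by simpa [hm] using hp
  exact Submodule.mem_span_singleton.2 ⟨p, by simp⟩

theorem IsONB.isAxis_of_apply_spacelike_eq (hs : h.IsSymm) (hb : IsONB h b)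
    (hL : L ∈ specialIsometryGroup h) (hL1 : L ≠ 1) (h1 : L (b 1) = b 1) : IsAxis L (b 1) := by
  obtain ⟨b', hb', hx⟩ := hb.exists_isLVB_apply_one_eq hs hb.2.1
  rw [← hx] at h1 ⊢
  exact hb'.isAxis_of_apply_spacelike_eq hs hL hL1 h1

/-- The causal type of the axis common to the symmetries of a normal form: the sign of `h` on it,
or `none` if the symmetries have no common axis. -/
def FormType.axisSign : FormType → Option SignType
  | .so2 | .z3 | .z2A => some (-1)
  | .z2B | .so11 => some 1
  | .real => some 0
  | .zero | .s3 | .z2z2 => none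

theorem apply_eq_of_mem_represented {A : Matrix (Fin 3) (Fin 3) ℝ} {i : Fin 3}
    (hA : A.col i = Pi.single i 1) (hL : L ∈ represented b A) : L (b i) = b i := by
  rw [mem_represented_iff.1 hL, ← A.col_apply, ← A.col_apply, ← A.col_apply, hA]
  fin_cases i <;> simp

theorem apply_eq_of_mem_closure_represented {A : Matrix (Fin 3) (Fin 3) ℝ} {i : Fin 3}
    (hA : A.col i = Pi.single i 1) (hL : L ∈ Subgroup.closure (represented b A)) :
    L (b i) = b i := by
  have hle : Subgroup.closure (represented b A) ≤ MulAction.stabilizer (V ≃ₗ[ℝ] V) (b i) :=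
    (Subgroup.closure_le _).2 fun _ hM => apply_eq_of_mem_represented hA hM
  exact hle hL

theorem matA_col_zero (θ : ℝ) : (matA θ).col 0 = Pi.single 0 1 := by
  ext j
  fin_cases j <;> rfl

theorem matB_col_one : matB.col 1 = Pi.single 1 1 := by
  ext j
  fin_cases j <;> rfl

theorem exists_isAxis (hs : h.IsSymm) (hb : IsAdapted h b c) (hL : L ∈ specialIsometryGroup h)
    (hL1 : L ≠ 1) (hLc : L ∈ symmetrySet h b c) {σ : SignType} (hσ : c.axisSign = some σ) :
    ∃ x, IsAxis L x ∧ SignType.sign (h x x) = σ := by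
  cases c with
  | so2 =>
    cases hσ
    obtain ⟨θ, hθ⟩ := hLc
    exact ⟨b 0, IsONB.isAxis_of_apply_timelike_eq hs hb hL hL1
      (apply_eq_of_mem_represented (matA_col_zero θ) hθ), by simp [hb.1]⟩
  | z3 | z2A =>
    cases hσ
    exact ⟨b 0, IsONB.isAxis_of_apply_timelike_eq hs hb hL hL1
      (apply_eq_of_mem_closure_represented (matA_col_zero _) hLc), by simp [hb.1]⟩
  | z2B =>
    cases hσ
    exact ⟨b 1, IsONB.isAxis_of_apply_spacelike_eq hs hb hL hL1
      (apply_eq_of_mem_closure_represented matB_col_one hLc), by simp [hb.2.1]⟩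
  | so11 =>
    cases hσ
    obtain ⟨l, -, hl⟩ := hLc
    exact ⟨b 1, IsLVB.isAxis_of_apply_spacelike_eq hs hb hL hL1
      (by simpa using (mem_represented_matC_iff.1 hl).2.1), by simp [hb.2.2.2.2.2]⟩
  | real =>
    cases hσ
    obtain ⟨m, hm⟩ := hLc
    exact ⟨b 0, IsLVB.isAxis_of_apply_lightlike_eq hs hb hL hL1
      (by simpa using (mem_represented_matN_iff.1 hm).1), by simp [hb.1]⟩
  | zero | s3 | z2z2 => cases hσ

theorem FormType.eq_of_order_eq_of_axisSign_eq (hc : c ≠ .zero) (hc' : c' ≠ .zero)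
    (horder : c.order = c'.order)
    (hsign : ∀ σ σ', c.axisSign = some σ → c'.axisSign = some σ' → σ = σ') : c = c' := by
  cases c <;> cases c' <;> simp_all [FormType.order, FormType.axisSign]

theorem formType_eq_of_coe_eq_symmetrySet {b' : Module.Basis (Fin 3) ℝ V} (hs : h.IsSymm)
    (hstab : ∃ L ∈ cubicStabilizer h K, L ≠ 1)
    (hb : IsAdapted h b c) (H : HasNormalForm K b c)
    (hS : (cubicStabilizer h K : Set (V ≃ₗ[ℝ] V)) = symmetrySet h b c)
    (hb' : IsAdapted h b' c') (H' : HasNormalForm K b' c')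
    (hS' : (cubicStabilizer h K : Set (V ≃ₗ[ℝ] V)) = symmetrySet h b' c') : c = c' := by
  by_cases hK : K = 0
  · rw [H.formType_eq_zero hK, H'.formType_eq_zero hK]
  have hc : c ≠ .zero := by rintro rfl; exact hK H
  have hc' : c' ≠ .zero := by rintro rfl; exact hK H'
  obtain ⟨L, hL, hL1⟩ := hstab
  have horder : c.order = c'.order :=
    ((hasIsoType_of_coe_eq_symmetrySet hs hb hS).card_eq_order hc).symm.trans
      ((hasIsoType_of_coe_eq_symmetrySet hs hb' hS').card_eq_order hc')
  refine FormType.eq_of_order_eq_of_axisSign_eq hc hc' horder fun σ σ' hσ hσ' => ?_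
  obtain ⟨x, hx, rfl⟩ := exists_isAxis hs hb hL.1 hL1 (hS.subset hL) hσ
  obtain ⟨y, hy, rfl⟩ := exists_isAxis hs hb' hL.1 hL1 (hS'.subset hL) hσ'
  exact hx.sign_apply_self_eq hy

end Uniqueness

end LorentzCubic

open LorentzCubic in
theorem theorem4p1 {V : Type*} [AddCommGroup V] [Module ℝ V]
    (h : LinearMap.BilinForm ℝ V) (hsymm : h.IsSymm)
    (hsig : ∃ b : Module.Basis (Fin 3) ℝ V, IsONB h b)
    (K : V →ₗ[ℝ] V →ₗ[ℝ] V) (hK : IsTracelessCubic h K)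
    (hstab : ∃ L ∈ cubicStabilizer h K, L ≠ 1) :
    (∃! c : FormType, ∃ b : Module.Basis (Fin 3) ℝ V,
      IsAdapted h b c ∧ HasNormalForm K b c ∧
        (cubicStabilizer h K : Set (V ≃ₗ[ℝ] V)) = symmetrySet h b c ∧
        HasIsoType (cubicStabilizer h K) c) ∧
    (∀ (c : FormType) (b : Module.Basis (Fin 3) ℝ V),
      IsAdapted h b c → HasNormalForm K b c →
        symmetrySet h b c ⊆ (cubicStabilizer h K : Set (V ≃ₗ[ℝ] V)) ∧
        (c ≠ .z2B → c ≠ .z2A →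
          symmetrySet h b c = (cubicStabilizer h K : Set (V ≃ₗ[ℝ] V)))) := by
  obtain ⟨b₀, hb₀⟩ := hsig
  obtain ⟨c, b, hb, H, hS⟩ := hb₀.attainsNormalForm hsymm hK hstab
  refine ⟨⟨c, ⟨b, hb, H, hS, hasIsoType_of_coe_eq_symmetrySet hsymm hb hS⟩, ?_⟩,
    fun c b hb H => ⟨symmetrySet_subset_cubicStabilizer hsymm hK hb H, fun hB hA =>
      (cubicStabilizer_eq_symmetrySet hsymm hK hb H hB hA).symm⟩⟩
  rintro c' ⟨b', hb', H', hS', -⟩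
  exact formType_eq_of_coe_eq_symmetrySet hsymm hstab hb' H' hS' hb H hS
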